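/- Let $\mathfrak H$ be a complex Hilbert space and $J$ a bounded operator on $\mathfrak H$ with $J=J^*$, $J^2=I$, $J\neq\pm I$; put $[x,y]=(Jx,y)$ and $\mathfrak H_\pm=\frac12(I\pm J)\mathfrak H$. Let $S$ be a closed densely defined symmetric operator in $\mathfrak H$ with $SJ=JS$, and assume that the operators $S_\pm=S\upharpoonright_{\mathfrak H_\pm}$ in $\mathfrak H_\pm$ both have deficiency indices $\langle 1,1\rangle$. Let $\Sigma_J$ be the set of all extensions of $S$ that are $J$-self-adjoint, i.e. self-adjoint with respect to $[\cdot,\cdot]$, and put $\mathfrak N_\mu=\ker(S^*-\mu I)$. Choose vectors of equal norm $e_{++},e_{+-},e_{-+},e_{--}$ with $\ker(S_+^*-iI)=\mathrm{span}\{e_{++}\}$, $\ker(S_-^*-iI)=\mathrm{span}\{e_{+-}\}$, $\ker(S_+^*+iI)=\mathrm{span}\{e_{-+}\}$, $\ker(S_-^*+iI)=\mathrm{span}\{e_{--}\}$. For a unitary $2\times2$ matrix $U=(U_{jk})$ let $A_U$ be the restriction of $S^*$ to $\mathcal D(S)\dotplus\mathrm{span}\{d_1,d_2\}$, where $$d_1=e_{++}+U_{11}e_{+-}+U_{12}e_{-+},\qquad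 d_2=e_{--}+U_{21}e_{+-}+U_{22}e_{-+}.$$ For $\mu\in\mathbb C_+$ (the open upper half plane) let $A_\mu=S^*\upharpoonright_{\mathcal D(S)\dotplus\mathfrak N_\mu}$ and let $\mathsf{Sh}(\mu)=(A_\mu-iI)(A_\mu+iI)^{-1}\upharpoonright_{\mathfrak N_i}$ be the characteristic function of $S$. Define $s_\pm:\mathbb C_+\to\mathbb C$ by $\mathsf{Sh}(\mu)e_{++}=s_+(\mu)e_{-+}$ and $\mathsf{Sh}(\mu)e_{+-}=s_-(\mu)e_{--}$. Assume that $s_+\approx s_-$, i.e. there is $\alpha\in\mathbb R$ with $e^{i\alpha}s_+(\mu)=s_-(\mu)$ for all $\mu\in\mathbb C_+$. Then $U\mapsto A_U$ is a bijection from the unitary $2\times 2$ matrices onto $\Sigma_J$, and the operators in $\Sigma_J$ with empty resolvent set are described as follows. 1. If $\mathsf{Sh}\not\equiv0$ on $\mathbb C_+$, then there is exactly one $\varphi\in[0,\pi)$ such that $$e^{2i\varphi}s_-(\mu)=s_+(\mu)\quad\text{for all }\mu\in\mathbb C_+,\qquad(*)$$ and for every real $\varphi$ satisfying $(*)$ and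 every unitary $U$, the resolvent set of $A_U$ is empty if and only if $$U=e^{i\varphi}\begin{pmatrix}e^{i\gamma}&0\\0&e^{-i\gamma}\end{pmatrix}\qquad(**)$$ for some $\gamma\in[0,2\pi)$. 2. If $\mathsf{Sh}\equiv0$ on $\mathbb C_+$, then for every unitary $U$ the resolvent set of $A_U$ is empty if and only if $U$ has the form $(**)$ for some $\varphi,\gamma\in[0,2\pi)$. -/

import Mathlib

noncomputable section

namespace JExt

open Complex

variable {H : Type*} [NormedAddCommGroup H] [InnerProductSpace ℂ H]

/-- The resolvent set of an (unbounded) operator `A`: all `μ` for which `A - μ` maps `D(A)`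
bijectively onto the whole space and has a bounded inverse `R`. -/
def resolventSet (A : H →ₗ.[ℂ] H) : Set ℂ :=
  {μ | ∃ R : H →L[ℂ] H, (∀ y, ∃ h : R y ∈ A.domain, A ⟨R y, h⟩ - μ • R y = y) ∧
    ∀ x : A.domain, R (A x - μ • (x : H)) = x}

/-- A non-trivial fundamental symmetry: `J = J*`, `J² = I`, `J ≠ I` and `J ≠ -I`. -/
structure IsFundamentalSymmetry [CompleteSpace H] (J : H →L[ℂ] H) : Prop where
  selfAdjoint : IsSelfAdjoint J
  sq : J * J = 1
  ne_one : J ≠ 1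
  ne_neg_one : J ≠ -1

/-- `A C = C A` for an unbounded operator `A` and a bounded operator `C`, with equality
of the natural domains `{x | C x ∈ D(A)}` and `D(A)` included. -/
def CommutesWith (A : H →ₗ.[ℂ] H) (C : H →L[ℂ] H) : Prop :=
  (∀ x, C x ∈ A.domain ↔ x ∈ A.domain) ∧
    ∀ (x : A.domain) (h : C x ∈ A.domain), A ⟨C x, h⟩ = C (A x)

/-- `A` is self-adjoint for the indefinite inner product `[x, y] = (J x, y)`: it is densely
defined, and `x ∈ D(A)`, `A x = y` holds exactly when `[A u, x] = [u, y]` for all `u ∈ D(A)`. -/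
def IsJSelfAdjoint (J : H →L[ℂ] H) (A : H →ₗ.[ℂ] H) : Prop :=
  Dense (A.domain : Set H) ∧
    ∀ x y : H, (x, y) ∈ A.graph ↔ ∀ u : A.domain, inner ℂ (J (A u)) x = inner ℂ (J u) y

/-- `Σ_J`: the set of all `J`-self-adjoint extensions of `S`. -/
def jSelfAdjointExtensions (J : H →L[ℂ] H) (S : H →ₗ.[ℂ] H) : Set (H →ₗ.[ℂ] H) :=
  {A | S ≤ A ∧ IsJSelfAdjoint J A}

/-- The subspace `H₊` of the fundamental decomposition, as the eigenspace of `J` for `1`. -/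
def posSubspace (J : H →L[ℂ] H) : Submodule ℂ H := (J - 1).ker

/-- The subspace `H₋` of the fundamental decomposition, as the eigenspace of `J` for `-1`. -/
def negSubspace (J : H →L[ℂ] H) : Submodule ℂ H := (J + 1).ker

/-- `H₊` is the range of the projector `P₊ = (I + J) / 2`. -/
theorem posSubspace_eq_range {J : H →L[ℂ] H} (hJ : J * J = 1) :
    posSubspace J = ((1 / 2 : ℂ) • (1 + J)).range := by
  have hJ' : ∀ x, J (J x) = x := fun x => by
    simpa using congrArg (fun T : H →L[ℂ] H => T x) hJ
  ext x
  simp only [posSubspace, LinearMap.mem_ker, LinearMap.mem_range, ContinuousLinearMap.coe_coe]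
  constructor
  · intro h
    have h1 : J x = x := sub_eq_zero.1 (by simpa using h)
    refine ⟨x, ?_⟩
    simp only [_root_.smul_apply, _root_.add_apply,
      one_apply_eq_self, h1]
    module
  · rintro ⟨y, rfl⟩
    simp [hJ', add_comm]

/-- `H₋` is the range of the projector `P₋ = (I - J) / 2`. -/
theorem negSubspace_eq_range {J : H →L[ℂ] H} (hJ : J * J = 1) :
    negSubspace J = ((1 / 2 : ℂ) • (1 - J)).range := by
  have hJ' : ∀ x, J (J x) = x := fun x => by
    simpa using congrArg (fun T : H →L[ℂ] H => T x) hJ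
  ext x
  simp only [negSubspace, LinearMap.mem_ker, LinearMap.mem_range, ContinuousLinearMap.coe_coe]
  constructor
  · intro h
    have h1 : J x = -x := eq_neg_of_add_eq_zero_left (by simpa using h)
    refine ⟨x, ?_⟩
    simp only [_root_.smul_apply, _root_.sub_apply,
      one_apply_eq_self, h1]
    module
  · rintro ⟨y, rfl⟩
    simp only [_root_.add_apply, _root_.smul_apply,
      _root_.sub_apply, one_apply_eq_self, map_smul, map_sub, hJ']
    module

instance [CompleteSpace H] (J : H →L[ℂ] H) : CompleteSpace (posSubspace J) :=
  (J - 1).isClosed_ker.completeSpace_coe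

instance [CompleteSpace H] (J : H →L[ℂ] H) : CompleteSpace (negSubspace J) :=
  (J + 1).isClosed_ker.completeSpace_coe

/-- The part of `A` in the subspace `K`, as an operator in `K`: `x ↦ A x`
for those `x ∈ K ∩ D(A)` with `A x ∈ K`. -/
def part (A : H →ₗ.[ℂ] H) (K : Submodule ℂ H) : K →ₗ.[ℂ] K :=
  (A.graph.comap (K.subtype.prodMap K.subtype)).toLinearPMap

theorem mem_graph_part (A : H →ₗ.[ℂ] H) (K : Submodule ℂ H) (x y : K) :
    (x, y) ∈ (part A K).graph ↔ ((x : H), (y : H)) ∈ A.graph := by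
  rw [part, Submodule.toLinearPMap_graph_eq]
  · simp
  · rintro ⟨a, b⟩ h (rfl : a = 0)
    have : ((0 : H), (b : H)) ∈ A.graph := by simpa using h
    exact Subtype.ext (A.graph_fst_eq_zero_snd this rfl)

variable [CompleteSpace H]

/-- The defect subspace `N_μ(T) = ker (T* - μ I)`. -/
def defect (T : H →ₗ.[ℂ] H) (μ : ℂ) : Submodule ℂ H :=
  T.adjoint.graph.comap (LinearMap.id.prod (μ • LinearMap.id))

/-- `T` has the finite deficiency indices `⟨m, n⟩`. -/
def HasDeficiencyIndices (T : H →ₗ.[ℂ] H) (m n : ℕ) : Prop :=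
  Module.rank ℂ (defect T I) = m ∧ Module.rank ℂ (defect T (-I)) = n

/-- The extension `A_μ = S* ↾ (D(S) + N_μ)` of `S`. -/
def strausExtension (S : H →ₗ.[ℂ] H) (μ : ℂ) : H →ₗ.[ℂ] H :=
  S.adjoint.domRestrict (S.domain ⊔ defect S μ)

/-- The Cayley transform `(A - i I) (A + i I)⁻¹`, through its graph
`{(A u + i u, A u - i u) | u ∈ D(A)}`. -/
def cayley (A : H →ₗ.[ℂ] H) : H →ₗ.[ℂ] H :=
  (A.graph.map ((LinearMap.snd ℂ H H + I • LinearMap.fst ℂ H H).prod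
    (LinearMap.snd ℂ H H - I • LinearMap.fst ℂ H H))).toLinearPMap

/-- The characteristic function `Sh(μ) = (A_μ - i I) (A_μ + i I)⁻¹ ↾ N_i` of `S`,
for `μ` in the open upper half plane. -/
def Sh (S : H →ₗ.[ℂ] H) (μ : ℂ) : H →ₗ.[ℂ] H :=
  (cayley (strausExtension S μ)).domRestrict (defect S I)

/-- `Sh ≡ 0` on the open upper half plane. -/
def ShIsZero (S : H →ₗ.[ℂ] H) : Prop :=
  ∀ μ : ℂ, 0 < μ.im → ∀ x : (Sh S μ).domain, Sh S μ x = 0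

/-- Generators `e₊₊, e₊₋, e₋₊, e₋₋`, of equal norms, of the one-dimensional defect subspaces
`N_i(S₊), N_i(S₋), N_{-i}(S₊), N_{-i}(S₋)` of the parts `S₊, S₋` of `S` in `H₊, H₋`.
(They form an orthogonal basis of `N_i ∔ N_{-i}` for the inner product
`2 [(x_i, y_i) + (x_{-i}, y_{-i})]`, whose norm is `√2 ‖x‖` on each of `N_i` and `N_{-i}`.) -/
structure DefectBasis (J : H →L[ℂ] H) (S : H →ₗ.[ℂ] H) where
  (pp pm mp mm : H)
  span_pp : (defect (part S (posSubspace J)) I).map (posSubspace J).subtype = ℂ ∙ pp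
  span_pm : (defect (part S (negSubspace J)) I).map (negSubspace J).subtype = ℂ ∙ pm
  span_mp : (defect (part S (posSubspace J)) (-I)).map (posSubspace J).subtype = ℂ ∙ mp
  span_mm : (defect (part S (negSubspace J)) (-I)).map (negSubspace J).subtype = ℂ ∙ mm
  norm_pm : ‖pm‖ = ‖pp‖
  norm_mp : ‖mp‖ = ‖pp‖
  norm_mm : ‖mm‖ = ‖pp‖

open Classical in
/-- The number `c` with `T e = c e'` (and `0` if there is none). -/
def ratio (T : H →ₗ.[ℂ] H) (e e' : H) : ℂ :=
  if h : ∃ c : ℂ, (e, c • e') ∈ T.graph then h.choose else 0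

namespace DefectBasis

variable {J : H →L[ℂ] H} {S : H →ₗ.[ℂ] H} (e : DefectBasis J S)

/-- The function `s₊`, determined by `Sh(μ) e₊₊ = s₊(μ) e₋₊`. -/
def sPlus (μ : ℂ) : ℂ := ratio (Sh S μ) e.pp e.mp

/-- The function `s₋`, determined by `Sh(μ) e₊₋ = s₋(μ) e₋₋`. -/
def sMinus (μ : ℂ) : ℂ := ratio (Sh S μ) e.pm e.mm

/-- `s₊ ≈ s₋`: equality on the open upper half plane up to a unimodular constant. -/
def SApprox : Prop :=
  ∃ α : ℝ, ∀ μ : ℂ, 0 < μ.im → exp (α * I) * e.sPlus μ = e.sMinus μ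

/-- The relation `e^{2iφ} s₋ = s₊` on the open upper half plane. -/
def PhaseRelation (φ : ℝ) : Prop :=
  ∀ μ : ℂ, 0 < μ.im → exp (2 * φ * I) * e.sMinus μ = e.sPlus μ

/-- The subspace `M` spanned by `d₁ = e₊₊ + U₁₁ e₊₋ + U₁₂ e₋₊` and
`d₂ = e₋₋ + U₂₁ e₊₋ + U₂₂ e₋₊`. -/
def M (U : Matrix (Fin 2) (Fin 2) ℂ) : Submodule ℂ H :=
  Submodule.span ℂ {e.pp + U 0 0 • e.pm + U 0 1 • e.mp, e.mm + U 1 0 • e.pm + U 1 1 • e.mp}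

/-- The operator `A_U = S* ↾ (D(S) + M)`. -/
def extension (U : Matrix (Fin 2) (Fin 2) ℂ) : H →ₗ.[ℂ] H :=
  S.adjoint.domRestrict (S.domain ⊔ e.M U)

end DefectBasis

/-- The matrix `e^{iφ} diag(e^{iγ}, e^{-iγ})`. -/
def diagU (φ γ : ℝ) : Matrix (Fin 2) (Fin 2) ℂ :=
  exp (φ * I) • !![exp (γ * I), 0; 0, exp (-γ * I)]

end JExt

end

/-!
Adding `N_i ∔ N_{-i}` to `S` gives `S*`, and in coordinates with respect to `e₊₊, e₋₋` and
`e₊₋, e₋₊` the indefinite form measuring `J`-self-adjointness becomes `‖x‖² - ‖y‖²` on `ℂ² × ℂ²`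
(up to a factor). A `J`-self-adjoint extension therefore corresponds to a hypermaximal neutral
subspace of `ℂ² × ℂ²`, that is, to the graph of a unitary matrix.

The vectors `e₊₊ - s₊(μ) e₋₊` and `e₊₋ - s₋(μ) e₋₋` span `N_μ` modulo `D(S)`, so `μ ∈ ℂ₊` is an
eigenvalue of `A_U` exactly when the determinant
`U₁₁ U₂₂ s₋(μ) - (1 + U₂₁ s₋(μ)) (U₁₂ + s₊(μ))` vanishes. Since `A_U - μ` is a Fredholm operator
of index `0`, the other points of `ℂ₊` lie in the resolvent set, and by `J`-symmetry
the resolvent set is empty as soon as all of `ℂ₊` consists of eigenvalues. At `μ = i`, where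
`s₊ = s₋ = 0`, the determinant is `-U₁₂`; hence `U` is diagonal and the condition reduces to
`U₁₁ U₂₂ s₋ = s₊`.
-/

noncomputable section

namespace JExt

open Complex ComplexConjugate
open scoped Matrix

section operatorGraph

section domRestrict

variable {R E F : Type*} [Ring R] [AddCommGroup E] [Module R E] [AddCommGroup F] [Module R F]

theorem mem_graph_domRestrict (A : E →ₗ.[R] F) (K : Submodule R E) {x : E} {y : F} :
    (x, y) ∈ (A.domRestrict K).graph ↔ x ∈ K ∧ (x, y) ∈ A.graph := by
  have hle : (A.domRestrict K).graph ≤ A.graph :=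
    LinearPMap.le_graph_of_le LinearPMap.domRestrict_le
  constructor
  · exact fun h => ⟨(LinearPMap.mem_domain_of_mem_graph h).1, hle h⟩
  · rintro ⟨hxK, hxy⟩
    have hx : x ∈ (A.domRestrict K).domain := ⟨hxK, LinearPMap.mem_domain_of_mem_graph hxy⟩
    obtain ⟨y', hy'⟩ := LinearPMap.mem_domain_iff.1 hx
    rwa [LinearPMap.mem_graph_snd_inj A hxy (hle hy') rfl]

theorem graph_domRestrict_map_fst (A : E →ₗ.[R] F) {G : Submodule R (E × F)} (hG : G ≤ A.graph) :
    (A.domRestrict (G.map (LinearMap.fst R E F))).graph = G := by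
  ext ⟨x, y⟩
  rw [mem_graph_domRestrict]
  constructor
  · rintro ⟨⟨⟨x', y'⟩, hG', rfl⟩, hxy⟩
    rwa [LinearPMap.mem_graph_snd_inj A hxy (hG hG') rfl]
  · exact fun hxy => ⟨⟨_, hxy, rfl⟩, hG hxy⟩

end domRestrict

variable {H : Type*} [NormedAddCommGroup H] [InnerProductSpace ℂ H]

/-- The operator `A - z`, as a bounded operator on the graph of `A`, which carries the graph
norm. -/
def shift (A : H →ₗ.[ℂ] H) (z : ℂ) : A.graph →L[ℂ] H :=
  (ContinuousLinearMap.snd ℂ H H - z • ContinuousLinearMap.fst ℂ H H) ∘L A.graph.subtypeL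

section shift

variable {A : H →ₗ.[ℂ] H}

theorem shift_apply (A : H →ₗ.[ℂ] H) (z : ℂ) (p : A.graph) : shift A z p = p.1.2 - z • p.1.1 := rfl

theorem injective_shift_iff {z : ℂ} :
    Function.Injective (shift A z) ↔ ∀ x, (x, z • x) ∈ A.graph → x = 0 := by
  rw [injective_iff_map_eq_zero]
  constructor
  · intro h x hx
    exact congrArg (fun p : A.graph => p.1.1) (h ⟨_, hx⟩ (by simp [shift_apply]))
  · rintro h ⟨⟨x, y⟩, hxy⟩ hz
    obtain rfl : y = z • x := sub_eq_zero.1 hz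
    obtain rfl := h x hxy
    simp

end shift

section symmetric

variable {S : H →ₗ.[ℂ] H}

theorem im_inner_smul_self (x : H) (μ : ℂ) : (inner ℂ x (μ • x)).im = μ.im * ‖x‖ ^ 2 := by
  rw [inner_smul_right, inner_self_eq_norm_sq_to_K]
  norm_cast
  simp [-ofReal_pow]

theorem im_inner_graph_eq_zero (hsymm : S.IsFormalAdjoint S) {u v : H}
    (huv : (u, v) ∈ S.graph) : (inner ℂ u v).im = 0 := by
  obtain ⟨x, rfl, rfl⟩ := (LinearPMap.mem_graph_iff _).1 huv
  apply Complex.conj_eq_iff_im.1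
  rw [inner_conj_symm]
  exact hsymm x x

theorem abs_im_mul_norm_le_norm_shift (hsymm : S.IsFormalAdjoint S) (z : ℂ) (p : S.graph) :
    |z.im| * ‖p.1.1‖ ≤ ‖shift S z p‖ := by
  have him : (inner ℂ p.1.1 (shift S z p)).im = -(z.im * ‖p.1.1‖ ^ 2) := by
    rw [shift_apply, inner_sub_right, sub_im, im_inner_graph_eq_zero hsymm p.2, zero_sub,
      im_inner_smul_self]
  rcases (norm_nonneg p.1.1).eq_or_lt with h0 | h0
  · simp [← h0]
  refine le_of_mul_le_mul_left ?_ h0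
  calc ‖p.1.1‖ * (|z.im| * ‖p.1.1‖) = |(inner ℂ p.1.1 (shift S z p)).im| := by
        rw [him, abs_neg, abs_mul, abs_sq]; ring
    _ ≤ ‖inner ℂ p.1.1 (shift S z p)‖ := abs_im_le_norm _
    _ ≤ ‖p.1.1‖ * ‖shift S z p‖ := norm_inner_le_norm _ _

variable [CompleteSpace H]

theorem mem_defect {μ : ℂ} {x : H} : x ∈ defect S μ ↔ (x, μ • x) ∈ S.adjoint.graph := Iff.rfl

theorem mem_graph_adjoint (hdense : Dense (S.domain : Set H)) {x y : H} :
    (x, y) ∈ S.adjoint.graph ↔ ∀ u v, (u, v) ∈ S.graph → inner ℂ v x = inner ℂ u y := by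
  simp only [LinearPMap.adjoint_graph_eq_graph_adjoint hdense, Submodule.mem_adjoint_iff,
    sub_eq_zero]

theorem graph_le_graph_adjoint (hdense : Dense (S.domain : Set H)) (hsymm : S.IsFormalAdjoint S) :
    S.graph ≤ S.adjoint.graph :=
  LinearPMap.le_graph_of_le (hsymm.le_adjoint hdense)

theorem graph_adjoint_domRestrict_sup (hdense : Dense (S.domain : Set H))
    (hsymm : S.IsFormalAdjoint S) {L : Submodule ℂ (H × H)} (hL : L ≤ S.adjoint.graph) :
    (S.adjoint.domRestrict (S.domain ⊔ L.map (LinearMap.fst ℂ H H))).graph = S.graph ⊔ L := by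
  rw [← LinearPMap.graph_map_fst_eq_domain, ← Submodule.map_sup,
    graph_domRestrict_map_fst _ (sup_le (graph_le_graph_adjoint hdense hsymm) hL)]

theorem orthogonal_range_shift (hdense : Dense (S.domain : Set H)) (z : ℂ) :
    (shift S z).rangeᗮ = defect S (conj z) := by
  ext x
  simp only [Submodule.mem_orthogonal, mem_defect, mem_graph_adjoint hdense]
  constructor
  · intro h u v huv
    have := h _ ⟨⟨_, huv⟩, rfl⟩
    simpa [shift_apply, inner_sub_left, inner_smul_left, inner_smul_right, sub_eq_zero] using this
  · rintro h _ ⟨⟨⟨u, v⟩, huv⟩, rfl⟩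
    simp [shift_apply, inner_sub_left, inner_smul_left, h u v huv]

theorem isClosed_range_shift (hclosed : S.IsClosed) (hsymm : S.IsFormalAdjoint S) {z : ℂ}
    (hz : z.im ≠ 0) : IsClosed ((shift S z).range : Set H) := by
  have : CompleteSpace S.graph := hclosed.completeSpace_coe
  have hpos : 0 < |z.im| := abs_pos.2 hz
  have hbound (p : S.graph) : ‖p‖ ≤ (1 + (1 + ‖z‖) / |z.im|) * ‖shift S z p‖ := by
    have hfst : ‖p.1.1‖ ≤ ‖shift S z p‖ / |z.im| := by
      rw [le_div_iff₀ hpos, mul_comm]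
      exact abs_im_mul_norm_le_norm_shift hsymm z p
    have hsnd : ‖p.1.2‖ ≤ ‖shift S z p‖ + ‖z‖ * ‖p.1.1‖ := by
      calc ‖p.1.2‖ = ‖shift S z p + z • p.1.1‖ := by rw [shift_apply, sub_add_cancel]
        _ ≤ _ := (norm_add_le _ _).trans_eq (by rw [norm_smul])
    calc ‖p‖ ≤ ‖p.1.1‖ + ‖p.1.2‖ :=
          max_le (le_add_of_nonneg_right (norm_nonneg _)) (le_add_of_nonneg_left (norm_nonneg _))
      _ ≤ ‖shift S z p‖ + (1 + ‖z‖) * ‖p.1.1‖ := by linarith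
      _ ≤ ‖shift S z p‖ + (1 + ‖z‖) * (‖shift S z p‖ / |z.im|) := by gcongr
      _ = _ := by ring
  have hanti : AntilipschitzWith ⟨1 + (1 + ‖z‖) / |z.im|, by positivity⟩ (shift S z) :=
    (shift S z).antilipschitz_of_bound hbound
  exact hanti.isClosed_range (shift S z).uniformContinuous

theorem orthogonal_defect (hdense : Dense (S.domain : Set H)) (hclosed : S.IsClosed)
    (hsymm : S.IsFormalAdjoint S) {z : ℂ} (hz : z.im ≠ 0) :
    (defect S (conj z))ᗮ = (shift S z).range := by
  have := (isClosed_range_shift hclosed hsymm hz).completeSpace_coe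
  rw [← orthogonal_range_shift hdense, Submodule.orthogonal_orthogonal]

end symmetric

end operatorGraph

section defectSubspace

variable {H : Type*} [NormedAddCommGroup H] [InnerProductSpace ℂ H]

theorem injective_orthogonalProjectionOnto_comp {V : Type*} [AddCommGroup V] [Module ℂ V]
    {K : Submodule ℂ H} [K.HasOrthogonalProjection] {T : V →ₗ[ℂ] H}
    (hT : ∀ v, T v ∈ Kᗮ → v = 0) :
    Function.Injective ((K.orthogonalProjectionOnto : H →ₗ[ℂ] K) ∘ₗ T) := by
  rw [injective_iff_map_eq_zero]
  exact fun v hv => hT v (Submodule.orthogonalProjectionOnto_eq_zero_iff.1 hv)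

variable [CompleteSpace H] {S A : H →ₗ.[ℂ] H}

theorem im_inner_graph_add (hdense : Dense (S.domain : Set H)) (hsymm : S.IsFormalAdjoint S)
    {u v b c : H} (huv : (u, v) ∈ S.graph) (hbc : (b, c) ∈ S.adjoint.graph) :
    (inner ℂ (u + b) (v + c)).im = (inner ℂ b c).im := by
  have hcross : inner ℂ u c = conj (inner ℂ b v) := by
    rw [inner_conj_symm, (mem_graph_adjoint hdense).1 hbc u v huv]
  rw [inner_add_left, inner_add_right, inner_add_right, hcross]
  simp only [add_im, conj_im, im_inner_graph_eq_zero hsymm huv]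
  ring

-- For `x = u + b` with `u ∈ D(S)`, `b ∈ N_w`, the imaginary part of `(x, S* x)` is
-- `Im w ‖b‖²`; for `x ∈ N_μ` it is `Im μ ‖x‖²`.
theorem disjoint_domain_sup_defect (hdense : Dense (S.domain : Set H))
    (hsymm : S.IsFormalAdjoint S) {w μ : ℂ} (h : w.im * μ.im < 0) :
    Disjoint (S.domain ⊔ defect S w) (defect S μ) := by
  rw [Submodule.disjoint_def]
  intro x hx hxμ
  obtain ⟨u, hu, b, hb, rfl⟩ := Submodule.mem_sup.1 hx
  obtain ⟨v, huv⟩ := LinearPMap.mem_domain_iff.1 hu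
  have hval : v + w • b = μ • (u + b) :=
    LinearPMap.mem_graph_snd_inj S.adjoint
      (add_mem (graph_le_graph_adjoint hdense hsymm huv) (mem_defect.1 hb)) hxμ rfl
  have him : w.im * ‖b‖ ^ 2 = μ.im * ‖u + b‖ ^ 2 := by
    rw [← im_inner_smul_self, ← im_inner_smul_self, ← hval,
      im_inner_graph_add hdense hsymm huv (mem_defect.1 hb)]
  have hle : μ.im * μ.im * ‖u + b‖ ^ 2 ≤ 0 := by
    calc μ.im * μ.im * ‖u + b‖ ^ 2 = w.im * μ.im * ‖b‖ ^ 2 := by linear_combination -μ.im * him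
      _ ≤ 0 := mul_nonpos_of_nonpos_of_nonneg h.le (sq_nonneg _)
  simpa using nonpos_of_mul_nonpos_right hle (mul_self_pos.2 (right_ne_zero_of_mul h.ne))

theorem disjoint_defect_orthogonal (hdense : Dense (S.domain : Set H)) (hclosed : S.IsClosed)
    (hsymm : S.IsFormalAdjoint S) {w μ : ℂ} (h : 0 < w.im * μ.im) :
    Disjoint (defect S μ) (defect S w)ᗮ := by
  rw [Submodule.disjoint_def]
  intro x hx hxw
  have hw : (conj w).im ≠ 0 := by simpa using left_ne_zero_of_mul h.ne'
  rw [← conj_conj w, orthogonal_defect hdense hclosed hsymm hw] at hxw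
  obtain ⟨⟨⟨u, v⟩, huv⟩, rfl⟩ := hxw
  change v - conj w • u ∈ defect S μ at hx
  change v - conj w • u = 0
  have hb : μ • u - v ∈ defect S (conj w) := by
    have := sub_mem (Submodule.smul_mem _ (μ - conj w) (graph_le_graph_adjoint hdense hsymm huv))
      (mem_defect.1 hx)
    rw [mem_defect]
    convert this using 1
    simp only [Prod.smul_mk, Prod.mk_sub_mk, Prod.mk.injEq]
    constructor <;> module
  refine Submodule.disjoint_def.1
    (disjoint_domain_sup_defect hdense hsymm (w := conj w) (μ := μ) (by simpa using h)) _ ?_ hx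
  refine Submodule.mem_sup.2 ⟨(μ - conj w) • u,
    Submodule.smul_mem _ _ (LinearPMap.mem_domain_of_mem_graph huv), _, neg_mem hb, ?_⟩
  module

theorem injective_orthogonalProjectionOnto_defect (hdense : Dense (S.domain : Set H))
    (hclosed : S.IsClosed) (hsymm : S.IsFormalAdjoint S) {w μ : ℂ} (h : 0 < w.im * μ.im)
    [(defect S w).HasOrthogonalProjection] :
    Function.Injective
      (((defect S w).orthogonalProjectionOnto : H →ₗ[ℂ] defect S w) ∘ₗ (defect S μ).subtype) :=
  injective_orthogonalProjectionOnto_comp fun v hv => Subtype.ext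
    (Submodule.disjoint_def.1 (disjoint_defect_orthogonal hdense hclosed hsymm h) _ v.2 hv)

theorem finiteDimensional_defect (hdense : Dense (S.domain : Set H)) (hclosed : S.IsClosed)
    (hsymm : S.IsFormalAdjoint S) {w μ : ℂ} (h : 0 < w.im * μ.im)
    [FiniteDimensional ℂ (defect S w)] : FiniteDimensional ℂ (defect S μ) :=
  .of_injective _ (injective_orthogonalProjectionOnto_defect hdense hclosed hsymm h)

theorem finrank_defect_eq (hdense : Dense (S.domain : Set H)) (hclosed : S.IsClosed)
    (hsymm : S.IsFormalAdjoint S) {w μ : ℂ} (h : 0 < w.im * μ.im)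
    [FiniteDimensional ℂ (defect S w)] :
    Module.finrank ℂ (defect S μ) = Module.finrank ℂ (defect S w) := by
  have := finiteDimensional_defect hdense hclosed hsymm h
  have h' : 0 < μ.im * w.im := mul_comm w.im μ.im ▸ h
  exact (LinearMap.finrank_le_finrank_of_injective
      (injective_orthogonalProjectionOnto_defect hdense hclosed hsymm h)).antisymm
    (LinearMap.finrank_le_finrank_of_injective
      (injective_orthogonalProjectionOnto_defect hdense hclosed hsymm h'))

/- Modulo `range (S - z)`, the operator `A - z` acts on `D(A) / D(S)` as an injective map into
`N_z̄`, so a dimension count applies. -/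
theorem surjective_shift_of_injective (hdense : Dense (S.domain : Set H)) (hclosed : S.IsClosed)
    (hsymm : S.IsFormalAdjoint S) (hSA : S ≤ A) {z : ℂ} (hz : z.im ≠ 0)
    [FiniteDimensional ℂ (defect S (conj z))] {V : Type*} [AddCommGroup V] [Module ℂ V]
    [FiniteDimensional ℂ V] (T : V →ₗ[ℂ] A.graph) (hT : ∀ v, (T v : H × H) ∈ S.graph → v = 0)
    (hdim : Module.finrank ℂ (defect S (conj z)) ≤ Module.finrank ℂ V)
    (hinj : Function.Injective (shift A z)) : Function.Surjective (shift A z) := by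
  have mem_orthogonal {y : H} : y ∈ (defect S (conj z))ᗮ ↔ ∃ p : S.graph, shift S z p = y := by
    rw [orthogonal_defect hdense hclosed hsymm hz]; rfl
  have hΦinj := injective_orthogonalProjectionOnto_comp (K := defect S (conj z))
    (T := (shift A z : A.graph →ₗ[ℂ] H) ∘ₗ T) fun v hv => by
      obtain ⟨p, hp⟩ := mem_orthogonal.1 hv
      have hpT : (⟨p, LinearPMap.le_graph_of_le hSA p.2⟩ : A.graph) = T v := hinj hp
      exact hT v (hpT ▸ p.2)
  intro y
  have hfinrank := (LinearMap.finrank_le_finrank_of_injective hΦinj).antisymm hdim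
  obtain ⟨v, hv⟩ := (LinearMap.injective_iff_surjective_of_finrank_eq_finrank hfinrank).1 hΦinj
    ((defect S (conj z)).orthogonalProjectionOnto y)
  have hsub : y - shift A z (T v) ∈ (defect S (conj z))ᗮ := by
    rw [← Submodule.orthogonalProjectionOnto_eq_zero_iff, map_sub, sub_eq_zero]
    exact hv.symm
  obtain ⟨p, hp⟩ := mem_orthogonal.1 hsub
  refine ⟨⟨p, LinearPMap.le_graph_of_le hSA p.2⟩ + T v, ?_⟩
  rw [map_add, ← eq_sub_iff_add_eq]
  exact hp

/-- The graph `{(a, z a) | a ∈ N_z}` of the restriction of `S*` to its eigenspace `N_z`. -/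
def defectGraph (S : H →ₗ.[ℂ] H) (z : ℂ) : Submodule ℂ (H × H) :=
  (defect S z).map (LinearMap.id.prod (z • LinearMap.id))

theorem mem_defectGraph {z : ℂ} {p : H × H} :
    p ∈ defectGraph S z ↔ p.1 ∈ defect S z ∧ p.2 = z • p.1 := by
  constructor
  · rintro ⟨a, ha, rfl⟩
    exact ⟨ha, rfl⟩
  · rintro ⟨h₁, h₂⟩
    exact ⟨p.1, h₁, Prod.ext rfl h₂.symm⟩

theorem defectGraph_le_graph_adjoint (S : H →ₗ.[ℂ] H) (z : ℂ) :
    defectGraph S z ≤ S.adjoint.graph :=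
  Submodule.map_comap_le _ _

theorem map_fst_defectGraph (S : H →ₗ.[ℂ] H) (z : ℂ) :
    (defectGraph S z).map (LinearMap.fst ℂ H H) = defect S z := by
  rw [defectGraph, ← Submodule.map_comp]
  exact Submodule.map_id _

theorem graph_adjoint_eq_sup (hdense : Dense (S.domain : Set H)) (hclosed : S.IsClosed)
    (hsymm : S.IsFormalAdjoint S) {z : ℂ} (hz : z.im ≠ 0) :
    S.adjoint.graph = S.graph ⊔ (defectGraph S z ⊔ defectGraph S (conj z)) := by
  refine le_antisymm ?_ (sup_le (graph_le_graph_adjoint hdense hsymm)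
    (sup_le (defectGraph_le_graph_adjoint S z) (defectGraph_le_graph_adjoint S _)))
  rintro ⟨f, g⟩ hfg
  have := (isClosed_range_shift hclosed hsymm hz).completeSpace_coe
  obtain ⟨_, ⟨⟨⟨u, v⟩, huv⟩, rfl⟩, c, hc, hsum⟩ :=
    (shift S z).range.exists_add_mem_mem_orthogonal (v := g - z • f)
  rw [orthogonal_range_shift hdense] at hc
  have hne : conj z - z ≠ 0 := fun h => hz (conj_eq_iff_im.1 (sub_eq_zero.1 h))
  obtain ⟨b, rfl⟩ : ∃ b, c = (conj z - z) • b := ⟨_, (smul_inv_smul₀ hne c).symm⟩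
  replace hc : b ∈ defect S (conj z) := (Submodule.smul_mem_iff _ hne).1 hc
  have hg : g = z • f + (v - z • u) + (conj z - z) • b := by
    rw [add_assoc, ← sub_eq_iff_eq_add']; exact hsum
  have ha : f - u - b ∈ defect S z := by
    have := sub_mem (sub_mem hfg (graph_le_graph_adjoint hdense hsymm huv)) (mem_defect.1 hc)
    rw [mem_defect]
    convert this using 1
    simp only [hg, Prod.mk_sub_mk, Prod.mk.injEq, true_and]
    module
  refine Submodule.mem_sup.2 ⟨(u, v), huv, (f - u - b, z • (f - u - b)) + (b, conj z • b),
    Submodule.add_mem_sup (mem_defectGraph.2 ⟨ha, rfl⟩) (mem_defectGraph.2 ⟨hc, rfl⟩), ?_⟩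
  simp only [hg, Prod.mk_add_mk, Prod.mk.injEq]
  constructor <;> module

end defectSubspace

section characteristicFunction

variable {H : Type*} [NormedAddCommGroup H] [InnerProductSpace ℂ H]

theorem mem_graph_cayley {A : H →ₗ.[ℂ] H} (hinj : Function.Injective (shift A (-I))) {a b : H} :
    (a, b) ∈ (cayley A).graph ↔ ∃ x y, (x, y) ∈ A.graph ∧ y + I • x = a ∧ y - I • x = b := by
  rw [cayley, Submodule.toLinearPMap_graph_eq]
  · simp [-LinearPMap.mem_graph_iff]
  · rintro _ ⟨⟨x, y⟩, hxy, rfl⟩ h0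
    obtain rfl : y = -I • x := by simpa using eq_neg_of_add_eq_zero_left h0
    obtain rfl := injective_shift_iff.1 hinj x hxy
    simp

variable [CompleteSpace H] {S : H →ₗ.[ℂ] H} {μ : ℂ}

theorem graph_strausExtension (hdense : Dense (S.domain : Set H)) (hsymm : S.IsFormalAdjoint S)
    (μ : ℂ) : (strausExtension S μ).graph = S.graph ⊔ defectGraph S μ := by
  rw [strausExtension, ← map_fst_defectGraph,
    graph_adjoint_domRestrict_sup hdense hsymm (defectGraph_le_graph_adjoint S μ)]

theorem injective_shift_strausExtension (hdense : Dense (S.domain : Set H))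
    (hsymm : S.IsFormalAdjoint S) (hμ : 0 < μ.im) :
    Function.Injective (shift (strausExtension S μ) (-I)) := by
  refine injective_shift_iff.2 fun x hx => ?_
  rw [strausExtension, mem_graph_domRestrict] at hx
  exact Submodule.disjoint_def.1
    (disjoint_domain_sup_defect hdense hsymm (by simpa using hμ)) x hx.1 hx.2

theorem surjective_shift_strausExtension (hdense : Dense (S.domain : Set H))
    (hclosed : S.IsClosed) (hsymm : S.IsFormalAdjoint S) (hμ : 0 < μ.im)
    [FiniteDimensional ℂ (defect S I)] :
    Function.Surjective (shift (strausExtension S μ) (-I)) := by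
  have h : 0 < I.im * μ.im := by simpa using hμ
  have := finiteDimensional_defect hdense hclosed hsymm h
  have hdim := finrank_defect_eq hdense hclosed hsymm h
  have hI : conj (-I) = I := by simp
  have hmem (a : defect S μ) : ((a : H), μ • (a : H)) ∈ (strausExtension S μ).graph := by
    rw [graph_strausExtension hdense hsymm]
    exact Submodule.mem_sup_right (mem_defectGraph.2 ⟨a.2, rfl⟩)
  have hle : S ≤ strausExtension S μ := LinearPMap.le_of_le_graph <| by
    rw [graph_strausExtension hdense hsymm]; exact le_sup_left
  rw [← hI] at hdim ‹FiniteDimensional ℂ (defect S I)›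
  refine surjective_shift_of_injective hdense hclosed hsymm hle (by simp)
    (((defect S μ).subtype.prod (μ • (defect S μ).subtype)).codRestrict _ hmem) ?_ hdim.ge
    (injective_shift_strausExtension hdense hsymm hμ)
  intro a ha
  exact Subtype.ext <| Submodule.disjoint_def.1
    (disjoint_domain_sup_defect hdense hsymm (w := -I) (by simpa using hμ)) a
    (Submodule.mem_sup_left (LinearPMap.mem_domain_of_mem_graph ha)) a.2

theorem mem_graph_Sh (hdense : Dense (S.domain : Set H)) (hsymm : S.IsFormalAdjoint S)
    (hμ : 0 < μ.im) {a b : H} (ha : a ∈ defect S I) (hb : b ∈ defect S (-I)) :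
    (a, b) ∈ (Sh S μ).graph ↔ a - b ∈ S.domain ⊔ defect S μ := by
  rw [Sh, mem_graph_domRestrict, and_iff_right ha,
    mem_graph_cayley (injective_shift_strausExtension hdense hsymm hμ)]
  constructor
  · rintro ⟨x, y, hxy, rfl, rfl⟩
    have hx := ((mem_graph_domRestrict _ _).1 hxy).1
    convert Submodule.smul_mem _ (2 * I) hx using 1
    module
  · intro hab
    have hgraph : (a - b, I • a - -I • b) ∈ (strausExtension S μ).graph :=
      (mem_graph_domRestrict _ _).2 ⟨hab, sub_mem (mem_defect.1 ha) (mem_defect.1 hb)⟩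
    refine ⟨_, _, Submodule.smul_mem _ (2 * I)⁻¹ hgraph, ?_, ?_⟩ <;>
    · match_scalars <;> field_simp <;> norm_num

theorem exists_mem_graph_Sh (hdense : Dense (S.domain : Set H)) (hclosed : S.IsClosed)
    (hsymm : S.IsFormalAdjoint S) (hμ : 0 < μ.im) [FiniteDimensional ℂ (defect S I)] {a : H}
    (ha : a ∈ defect S I) : ∃ b ∈ defect S (-I), (a, b) ∈ (Sh S μ).graph := by
  obtain ⟨⟨⟨x, y⟩, hxy⟩, hsum⟩ := surjective_shift_strausExtension hdense hclosed hsymm hμ a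
  obtain rfl : a = y + I • x := by simpa [shift_apply] using hsum.symm
  refine ⟨y - I • x, ?_, (mem_graph_domRestrict _ _).2
    ⟨ha, (mem_graph_cayley (injective_shift_strausExtension hdense hsymm hμ)).2
      ⟨x, y, hxy, rfl, rfl⟩⟩⟩
  have := sub_mem (mem_defect.1 ha)
    (Submodule.smul_mem _ (2 * I) ((mem_graph_domRestrict _ _).1 hxy).2)
  rw [mem_defect]
  convert this using 1
  simp only [Prod.smul_mk, Prod.mk_sub_mk, Prod.mk.injEq]
  constructor
  · module
  · match_scalars
    · ring
    · simp

end characteristicFunction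

section jSymmetric

variable {H : Type*} [NormedAddCommGroup H] [InnerProductSpace ℂ H]

theorem mem_posSubspace {J : H →L[ℂ] H} {x : H} : x ∈ posSubspace J ↔ J x = x := by
  simp [posSubspace, sub_eq_zero]

theorem mem_negSubspace {J : H →L[ℂ] H} {x : H} : x ∈ negSubspace J ↔ J x = -x := by
  simp [negSubspace, add_eq_zero_iff_eq_neg]

theorem posSubspace_neg (J : H →L[ℂ] H) : posSubspace (-J) = negSubspace J := by
  ext x
  rw [mem_posSubspace, mem_negSubspace, _root_.neg_apply, neg_eq_iff_eq_neg]

variable [CompleteSpace H] {S : H →ₗ.[ℂ] H} {J : H →L[ℂ] H} {μ : ℂ}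

theorem map_defect_part (hdense : Dense (S.domain : Set H)) {K : Submodule ℂ H} [CompleteSpace K]
    (hK : ∀ u v, (u, v) ∈ S.graph → (K.starProjection u, K.starProjection v) ∈ S.graph) (z : ℂ) :
    (defect (part S K) z).map K.subtype = K ⊓ defect S z := by
  have hpart (u v : H) (huv : (u, v) ∈ S.graph) :
      (K.orthogonalProjectionOnto u, K.orthogonalProjectionOnto v) ∈ (part S K).graph :=
    (mem_graph_part S K _ _).2 (hK u v huv)
  have hdensePart : Dense ((part S K).domain : Set K) := by
    have hsurj : Function.Surjective K.orthogonalProjectionOnto := fun x => ⟨x, by simp⟩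
    refine (hsurj.denseRange.dense_image K.orthogonalProjectionOnto.continuous hdense).mono ?_
    rintro _ ⟨u, hu, rfl⟩
    obtain ⟨v, huv⟩ := LinearPMap.mem_domain_iff.1 hu
    exact LinearPMap.mem_domain_of_mem_graph (hpart u v huv)
  have hdefect (x : K) : x ∈ defect (part S K) z ↔ (x : H) ∈ defect S z := by
    rw [mem_defect, mem_defect, mem_graph_adjoint hdensePart, mem_graph_adjoint hdense]
    constructor
    · intro hx u v huv
      simpa [inner_smul_right] using hx _ _ (hpart u v huv)
    · intro hx u v huv
      exact hx u v ((mem_graph_part S K u v).1 huv)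
  ext x
  simp only [Submodule.mem_map, hdefect, Submodule.mem_inf]
  exact ⟨by rintro ⟨x, hx, rfl⟩; exact ⟨x.2, hx⟩, fun ⟨hxK, hx⟩ => ⟨⟨x, hxK⟩, hx, rfl⟩⟩

/-- `S` is a closed densely defined symmetric operator that commutes with the (possibly trivial)
fundamental symmetry `J`. The notion is invariant under `J ↦ -J`, which exchanges `H₊` and
`H₋`. -/
structure IsJSymmetric (J : H →L[ℂ] H) (S : H →ₗ.[ℂ] H) : Prop where
  selfAdjoint : IsSelfAdjoint J
  sq : J * J = 1
  dense : Dense (S.domain : Set H)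
  closed : S.IsClosed
  symm : S.IsFormalAdjoint S
  comm : CommutesWith S J

namespace IsJSymmetric

theorem neg (h : IsJSymmetric J S) : IsJSymmetric (-J) S where
  selfAdjoint := h.selfAdjoint.neg
  sq := by rw [neg_mul_neg, h.sq]
  dense := h.dense
  closed := h.closed
  symm := h.symm
  comm := by
    refine ⟨fun x => by simpa using h.comm.1 x, fun x hx => ?_⟩
    have hx' : J x ∈ S.domain := by simpa using hx
    have : (⟨(-J) x, hx⟩ : S.domain) = -⟨J x, hx'⟩ := rfl
    rw [this, S.map_neg, h.comm.2 x hx']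
    rfl

theorem map_map (h : IsJSymmetric J S) (x : H) : J (J x) = x :=
  congrArg (fun T : H →L[ℂ] H => T x) h.sq

theorem inner_map_left (h : IsJSymmetric J S) (x y : H) : inner ℂ (J x) y = inner ℂ x (J y) :=
  h.selfAdjoint.isSymmetric x y

theorem map_mem_graph (h : IsJSymmetric J S) {u v : H} (huv : (u, v) ∈ S.graph) :
    (J u, J v) ∈ S.graph := by
  obtain ⟨x, rfl, rfl⟩ := (LinearPMap.mem_graph_iff _).1 huv
  have hx : J x ∈ S.domain := (h.comm.1 x).2 x.2
  exact (LinearPMap.mem_graph_iff _).2 ⟨⟨J x, hx⟩, rfl, h.comm.2 x hx⟩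

theorem map_mem_graph_adjoint (h : IsJSymmetric J S) {f g : H} (hfg : (f, g) ∈ S.adjoint.graph) :
    (J f, J g) ∈ S.adjoint.graph := by
  rw [mem_graph_adjoint h.dense] at hfg ⊢
  intro u v huv
  rw [← h.inner_map_left, ← h.inner_map_left, hfg _ _ (h.map_mem_graph huv)]

theorem map_mem_defect (h : IsJSymmetric J S) {z : ℂ} {x : H} (hx : x ∈ defect S z) :
    J x ∈ defect S z := by
  simpa [mem_defect, -LinearPMap.mem_graph_iff] using h.map_mem_graph_adjoint (mem_defect.1 hx)

theorem inner_pos_neg_eq_zero (h : IsJSymmetric J S) {x y : H} (hx : x ∈ posSubspace J)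
    (hy : y ∈ negSubspace J) : inner ℂ x y = 0 := by
  have := h.inner_map_left x y
  rw [mem_posSubspace.1 hx, mem_negSubspace.1 hy, inner_neg_right] at this
  exact self_eq_neg.1 this

theorem starProjection_apply (h : IsJSymmetric J S) {K : Submodule ℂ H} [K.HasOrthogonalProjection]
    (hK : K = posSubspace J) (x : H) : K.starProjection x = (2⁻¹ : ℂ) • (x + J x) := by
  have hK {y : H} : y ∈ K ↔ J y = y := by rw [hK, mem_posSubspace]
  refine Submodule.eq_starProjection_of_mem_of_inner_eq_zero ?_ fun w hw => ?_
  · rw [hK, map_smul, map_add, h.map_map, add_comm]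
  · have hxw : inner ℂ (J x) w = inner ℂ x w := by rw [h.inner_map_left, hK.1 hw]
    rw [inner_sub_left, inner_smul_left, inner_add_left, hxw]
    rw [← two_mul, conj_inv, conj_ofNat, inv_mul_cancel_left₀ two_ne_zero, sub_self]

theorem map_defect_part (h : IsJSymmetric J S) {K : Submodule ℂ H} [CompleteSpace K]
    (hK : K = posSubspace J) (z : ℂ) :
    (defect (part S K) z).map K.subtype = K ⊓ defect S z := by
  refine JExt.map_defect_part h.dense (fun u v huv => ?_) z
  rw [h.starProjection_apply hK, h.starProjection_apply hK]
  exact Submodule.smul_mem _ _ (add_mem huv (h.map_mem_graph huv))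

theorem defect_eq_sup (h : IsJSymmetric J S) (z : ℂ) :
    defect S z = posSubspace J ⊓ defect S z ⊔ negSubspace J ⊓ defect S z := by
  refine le_antisymm (fun x hx => ?_) (sup_le inf_le_right inf_le_right)
  have hJx := h.map_mem_defect hx
  refine Submodule.mem_sup.2 ⟨(2⁻¹ : ℂ) • (x + J x), ⟨mem_posSubspace.2 ?_, ?_⟩,
    (2⁻¹ : ℂ) • (x - J x), ⟨mem_negSubspace.2 ?_, ?_⟩, by module⟩
  · rw [map_smul, map_add, h.map_map, add_comm]
  · exact Submodule.smul_mem _ _ (add_mem hx hJx)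
  · rw [map_smul, map_sub, h.map_map, ← smul_neg, neg_sub]
  · exact Submodule.smul_mem _ _ (sub_mem hx hJx)

theorem map_mem_graph_Sh (h : IsJSymmetric J S) (hμ : 0 < μ.im) {a b : H} (ha : a ∈ defect S I)
    (hb : b ∈ defect S (-I)) (hab : (a, b) ∈ (Sh S μ).graph) : (J a, J b) ∈ (Sh S μ).graph := by
  rw [mem_graph_Sh h.dense h.symm hμ ha hb] at hab
  rw [mem_graph_Sh h.dense h.symm hμ (h.map_mem_defect ha) (h.map_mem_defect hb), ← map_sub]
  obtain ⟨u, hu, c, hc, hsum⟩ := Submodule.mem_sup.1 hab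
  rw [← hsum, map_add]
  exact Submodule.add_mem_sup ((h.comm.1 u).2 hu) (h.map_mem_defect hc)

theorem exists_smul_mem_graph_Sh (h : IsJSymmetric J S) [FiniteDimensional ℂ (defect S I)]
    (hμ : 0 < μ.im) {a b : H} (ha : a ∈ posSubspace J ⊓ defect S I)
    (hb : posSubspace J ⊓ defect S (-I) ≤ ℂ ∙ b) :
    ∃ c : ℂ, (a, c • b) ∈ (Sh S μ).graph := by
  obtain ⟨x, hx, hax⟩ := exists_mem_graph_Sh h.dense h.closed h.symm hμ ha.2
  have hJx : J x = x := LinearPMap.mem_graph_snd_inj _ (h.map_mem_graph_Sh hμ ha.2 hx hax) hax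
    (mem_posSubspace.1 ha.1)
  obtain ⟨c, rfl⟩ := Submodule.mem_span_singleton.1 (hb ⟨mem_posSubspace.2 hJx, hx⟩)
  exact ⟨c, hax⟩

end IsJSymmetric

theorem mem_graph_ratio {E : Type*} [NormedAddCommGroup E] [InnerProductSpace ℂ E]
    {T : E →ₗ.[ℂ] E} {x y : E} (h : ∃ c : ℂ, (x, c • y) ∈ T.graph) :
    (x, ratio T x y • y) ∈ T.graph := by
  rw [ratio, dif_pos h]
  exact h.choose_spec

namespace DefectBasis

theorem pos_inf_defect_I (e : DefectBasis J S) (h : IsJSymmetric J S) :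
    posSubspace J ⊓ defect S I = ℂ ∙ e.pp :=
  (h.map_defect_part rfl I).symm.trans e.span_pp

theorem pos_inf_defect_neg_I (e : DefectBasis J S) (h : IsJSymmetric J S) :
    posSubspace J ⊓ defect S (-I) = ℂ ∙ e.mp :=
  (h.map_defect_part rfl (-I)).symm.trans e.span_mp

theorem neg_inf_defect_I (e : DefectBasis J S) (h : IsJSymmetric J S) :
    negSubspace J ⊓ defect S I = ℂ ∙ e.pm :=
  (h.neg.map_defect_part (posSubspace_neg J).symm I).symm.trans e.span_pm

theorem neg_inf_defect_neg_I (e : DefectBasis J S) (h : IsJSymmetric J S) :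
    negSubspace J ⊓ defect S (-I) = ℂ ∙ e.mm :=
  (h.neg.map_defect_part (posSubspace_neg J).symm (-I)).symm.trans e.span_mm

variable (e : DefectBasis J S)

theorem pp_mem (h : IsJSymmetric J S) : e.pp ∈ posSubspace J ⊓ defect S I :=
  e.pos_inf_defect_I h ▸ Submodule.mem_span_singleton_self e.pp

theorem pm_mem (h : IsJSymmetric J S) : e.pm ∈ negSubspace J ⊓ defect S I :=
  e.neg_inf_defect_I h ▸ Submodule.mem_span_singleton_self e.pm

theorem mp_mem (h : IsJSymmetric J S) : e.mp ∈ posSubspace J ⊓ defect S (-I) :=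
  e.pos_inf_defect_neg_I h ▸ Submodule.mem_span_singleton_self e.mp

theorem mm_mem (h : IsJSymmetric J S) : e.mm ∈ negSubspace J ⊓ defect S (-I) :=
  e.neg_inf_defect_neg_I h ▸ Submodule.mem_span_singleton_self e.mm

theorem defect_I (h : IsJSymmetric J S) : defect S I = (ℂ ∙ e.pp) ⊔ (ℂ ∙ e.pm) := by
  rw [h.defect_eq_sup, e.pos_inf_defect_I h, e.neg_inf_defect_I h]

theorem defect_neg_I (h : IsJSymmetric J S) : defect S (-I) = (ℂ ∙ e.mp) ⊔ (ℂ ∙ e.mm) := by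
  rw [h.defect_eq_sup, e.pos_inf_defect_neg_I h, e.neg_inf_defect_neg_I h]

theorem finiteDimensional_defect_I (e : DefectBasis J S) (h : IsJSymmetric J S) :
    FiniteDimensional ℂ (defect S I) := by
  rw [e.defect_I h]
  infer_instance

theorem finiteDimensional_defect_neg_I (e : DefectBasis J S) (h : IsJSymmetric J S) :
    FiniteDimensional ℂ (defect S (-I)) := by
  rw [e.defect_neg_I h]
  infer_instance

theorem finrank_defect_neg_I_le (e : DefectBasis J S) (h : IsJSymmetric J S) :
    Module.finrank ℂ (defect S (-I)) ≤ 2 := by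
  have hle (x : H) : Module.finrank ℂ (ℂ ∙ x) ≤ 1 := by simpa using finrank_span_le_card {x}
  rw [e.defect_neg_I h]
  exact (Submodule.finrank_add_le_finrank_add_finrank _ _).trans (add_le_add (hle _) (hle _))

theorem pp_ne_zero (e : DefectBasis J S)
    (hplus : Module.rank ℂ (defect (part S (posSubspace J)) I) = 1) : e.pp ≠ 0 := by
  intro hpp
  have hspan := e.span_pp
  rw [hpp, Submodule.span_zero_singleton, ← Submodule.map_bot (posSubspace J).subtype] at hspan
  have hbot := Submodule.map_injective_of_injective (posSubspace J).injective_subtype hspan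
  rw [hbot, rank_bot] at hplus
  exact zero_ne_one hplus

theorem mem_graph_Sh_pp (h : IsJSymmetric J S) (hμ : 0 < μ.im) :
    (e.pp, e.sPlus μ • e.mp) ∈ (Sh S μ).graph := by
  have := e.finiteDimensional_defect_I h
  exact mem_graph_ratio
    (h.exists_smul_mem_graph_Sh hμ (e.pp_mem h) (e.pos_inf_defect_neg_I h).le)

theorem mem_graph_Sh_pm (h : IsJSymmetric J S) (hμ : 0 < μ.im) :
    (e.pm, e.sMinus μ • e.mm) ∈ (Sh S μ).graph := by
  have := e.finiteDimensional_defect_I h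
  exact mem_graph_ratio (h.neg.exists_smul_mem_graph_Sh hμ (posSubspace_neg J ▸ e.pm_mem h)
    (posSubspace_neg J ▸ (e.neg_inf_defect_neg_I h).le))

end DefectBasis

end jSymmetric

section hypermaximal

variable {n : Type*} [Fintype n]

/-- A subspace of `ℂⁿ × ℂⁿ` is hypermaximal neutral if it is its own orthogonal complement for the
indefinite form `(x, y), (x', y') ↦ x* x' - y* y'`. -/
def IsHypermaximalNeutral (L : Submodule ℂ ((n → ℂ) × (n → ℂ))) : Prop :=
  ∀ p, p ∈ L ↔ ∀ q ∈ L, star q.1 ⬝ᵥ p.1 = star q.2 ⬝ᵥ p.2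

theorem mem_graph_vecMulLinear {U : Matrix n n ℂ} {p : (n → ℂ) × (n → ℂ)} :
    p ∈ U.vecMulLinear.graph ↔ p.2 = p.1 ᵥ* U := by
  rw [LinearMap.mem_graph_iff, Matrix.vecMulLinear_apply]

theorem graph_vecMulLinear_injective :
    Function.Injective fun U : Matrix n n ℂ => U.vecMulLinear.graph := by
  classical
  intro U V hUV
  ext i j
  have hrow : (Pi.single i 1, Pi.single i 1 ᵥ* U) ∈ V.vecMulLinear.graph :=
    hUV.le (mem_graph_vecMulLinear.2 rfl)
  simpa using congrFun (mem_graph_vecMulLinear.1 hrow) j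

open scoped ComplexOrder in
theorem IsHypermaximalNeutral.map_fst_eq_top {L : Submodule ℂ ((n → ℂ) × (n → ℂ))}
    (hL : IsHypermaximalNeutral L) : L.map (LinearMap.fst ℂ _ _) = ⊤ := by
  classical
  by_contra hne
  obtain ⟨f, hf, hle⟩ := Submodule.exists_le_ker_of_lt_top _ (lt_top_iff_ne_top.2 hne)
  obtain ⟨w, rfl⟩ := (dotProductEquiv ℂ n).surjective f
  have hw : (star w, 0) ∈ L := (hL _).2 fun q hq => by
    have : w ⬝ᵥ q.1 = 0 := hle ⟨q, hq, rfl⟩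
    rw [Matrix.star_dotProduct_star, this, star_zero, dotProduct_zero]
  have : w ⬝ᵥ star w = 0 := by simpa using (hL _).1 hw _ hw
  exact hf (by rw [dotProduct_self_star_eq_zero.1 this, map_zero])

variable [DecidableEq n]

theorem isHypermaximalNeutral_graph {U : Matrix n n ℂ} (hU : U ∈ Matrix.unitaryGroup n ℂ) :
    IsHypermaximalNeutral U.vecMulLinear.graph := by
  rintro ⟨x, y⟩
  have hadjoint (z : n → ℂ) : star (z ᵥ* U) ⬝ᵥ y = star z ⬝ᵥ (y ᵥ* Uᴴ) := by
    rw [Matrix.star_vecMul, dotProduct_comm, Matrix.dotProduct_mulVec, dotProduct_comm]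
  calc (x, y) ∈ U.vecMulLinear.graph ↔ y = x ᵥ* U := mem_graph_vecMulLinear
    _ ↔ x = y ᵥ* Uᴴ := by
      constructor
      · rintro rfl
        rw [Matrix.vecMul_vecMul, ← Matrix.star_eq_conjTranspose, Matrix.mem_unitaryGroup_iff.1 hU,
          Matrix.vecMul_one]
      · rintro rfl
        rw [Matrix.vecMul_vecMul, ← Matrix.star_eq_conjTranspose, Matrix.mem_unitaryGroup_iff'.1 hU,
          Matrix.vecMul_one]
    _ ↔ ∀ q ∈ U.vecMulLinear.graph, star q.1 ⬝ᵥ x = star q.2 ⬝ᵥ y := by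
      constructor
      · rintro hx ⟨z, z'⟩ hq
        obtain rfl : z' = z ᵥ* U := mem_graph_vecMulLinear.1 hq
        exact (congrArg (star z ⬝ᵥ ·) hx).trans (hadjoint z).symm
      · intro h
        refine dotProduct_eq _ _ fun z => ?_
        have := (h (star z, star z ᵥ* U) (mem_graph_vecMulLinear.2 rfl)).trans (hadjoint _)
        simpa only [star_star, dotProduct_comm z] using this

theorem IsHypermaximalNeutral.exists_eq_graph {L : Submodule ℂ ((n → ℂ) × (n → ℂ))}
    (hL : IsHypermaximalNeutral L) :
    ∃ U ∈ Matrix.unitaryGroup n ℂ, L = U.vecMulLinear.graph := by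
  have hrow (i : n) : ∃ y, (Pi.single i 1, y) ∈ L := by
    obtain ⟨⟨_, y⟩, hy, rfl⟩ := (hL.map_fst_eq_top ▸ Submodule.mem_top :
      (Pi.single i 1 : n → ℂ) ∈ L.map (LinearMap.fst ℂ _ _))
    exact ⟨y, hy⟩
  choose y hy using hrow
  have hU : Matrix.of y ∈ Matrix.unitaryGroup n ℂ := by
    rw [Matrix.mem_unitaryGroup_iff]
    ext i j
    have := (hL _).1 (hy i) _ (hy j)
    simpa [Matrix.mul_apply, dotProduct, Matrix.one_apply, Pi.single_apply, eq_comm (a := i),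
      mul_comm] using this.symm
  have hle : (Matrix.of y).vecMulLinear.graph ≤ L := by
    rintro ⟨x, z⟩ hxz
    obtain rfl : z = x ᵥ* Matrix.of y := mem_graph_vecMulLinear.1 hxz
    have hsum : (x, x ᵥ* Matrix.of y) = ∑ i, x i • (Pi.single i 1, y i) := by
      refine Prod.ext ?_ ?_
      · rw [Prod.fst_sum]
        exact pi_eq_sum_univ' x
      · rw [Prod.snd_sum]
        exact Matrix.vecMul_eq_sum x _
    rw [hsum]
    exact Submodule.sum_mem _ fun i _ => Submodule.smul_mem _ _ (hy i)
  refine ⟨_, hU, le_antisymm (fun p hp => ?_) hle⟩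
  exact (isHypermaximalNeutral_graph hU p).2 fun q hq => (hL p).1 hp q (hle hq)

end hypermaximal

section extensionCoordinates

variable {H : Type*} [NormedAddCommGroup H] [InnerProductSpace ℂ H]

/-- The form `[y, x'] - [x, y']` of pairs `(x, y), (x', y')`: the `J`-adjoint of an operator has
as its graph the orthogonal complement of the graph with respect to this form. -/
def jForm (J : H →L[ℂ] H) : (H × H) →ₗ⋆[ℂ] (H × H) →ₗ[ℂ] ℂ :=
  LinearMap.mk₂'ₛₗ (starRingEnd ℂ) (RingHom.id ℂ)
    (fun p q => inner ℂ (J p.2) q.1 - inner ℂ (J p.1) q.2)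
    (fun p p' q => by simp only [Prod.fst_add, Prod.snd_add, map_add, inner_add_left]; ring)
    (fun c p q => by
      simp only [Prod.smul_fst, Prod.smul_snd, map_smul, inner_smul_left, smul_eq_mul, mul_sub])
    (fun p q q' => by simp only [Prod.fst_add, Prod.snd_add, inner_add_right]; ring)
    (fun c p q => by
      simp only [Prod.smul_fst, Prod.smul_snd, inner_smul_right, smul_eq_mul, mul_sub,
        RingHom.id_apply])

theorem jForm_apply (J : H →L[ℂ] H) (p q : H × H) :
    jForm J p q = inner ℂ (J p.2) q.1 - inner ℂ (J p.1) q.2 := rfl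

theorem isJSelfAdjoint_iff {J : H →L[ℂ] H} {A : H →ₗ.[ℂ] H} :
    IsJSelfAdjoint J A ↔ Dense (A.domain : Set H) ∧
      ∀ p, p ∈ A.graph ↔ ∀ q ∈ A.graph, jForm J q p = 0 := by
  refine and_congr_right fun _ => ?_
  simp only [jForm_apply, sub_eq_zero, Prod.forall (p := fun p => p ∈ A.graph ↔ _)]
  refine forall₂_congr fun x y => iff_congr Iff.rfl ?_
  constructor
  · rintro h ⟨u, v⟩ huv
    obtain ⟨x, rfl, rfl⟩ := (LinearPMap.mem_graph_iff _).1 huv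
    exact h x
  · exact fun h x => h _ (A.mem_graph x)

variable [CompleteSpace H] {S A : H →ₗ.[ℂ] H} {J : H →L[ℂ] H}

namespace IsJSymmetric

theorem jForm_swap (h : IsJSymmetric J S) (p q : H × H) : jForm J p q = -conj (jForm J q p) := by
  simp only [jForm_apply, map_sub, inner_conj_symm, h.inner_map_left]
  ring

theorem mem_graph_adjoint_iff (h : IsJSymmetric J S) {p : H × H} :
    p ∈ S.adjoint.graph ↔ ∀ q ∈ S.graph, jForm J q p = 0 := by
  simp only [jForm_apply, sub_eq_zero]
  constructor
  · rintro hp ⟨u, v⟩ huv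
    exact (mem_graph_adjoint h.dense).1 hp _ _ (h.map_mem_graph huv)
  · refine fun hp => (mem_graph_adjoint h.dense).2 fun u v huv => ?_
    simpa only [h.map_map] using hp _ (h.map_mem_graph huv)

theorem jForm_add_add (h : IsJSymmetric J S) {u v p q : H × H} (hu : u ∈ S.graph)
    (hv : v ∈ S.graph) (hp : p ∈ S.adjoint.graph) (hq : q ∈ S.adjoint.graph) :
    jForm J (u + p) (v + q) = jForm J p q := by
  have hS := graph_le_graph_adjoint h.dense h.symm
  have huv := h.mem_graph_adjoint_iff.1 (hS hv) u hu
  have huq := h.mem_graph_adjoint_iff.1 hq u hu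
  have hpv : jForm J p v = 0 := by
    rw [h.jForm_swap, h.mem_graph_adjoint_iff.1 hp v hv, map_zero, neg_zero]
  simp only [map_add, LinearMap.add_apply, huv, huq, hpv, zero_add]

theorem graph_le_graph_adjoint_of_le (h : IsJSymmetric J S) (hSA : S ≤ A)
    (hA : IsJSelfAdjoint J A) : A.graph ≤ S.adjoint.graph := fun p hp =>
  h.mem_graph_adjoint_iff.2 fun q hq =>
    ((isJSelfAdjoint_iff.1 hA).2 p).1 hp q (LinearPMap.le_graph_of_le hSA hq)

end IsJSymmetric

namespace DefectBasis

variable (e : DefectBasis J S)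

/-- Coordinates on `N_i ∔ N_{-i}`, embedded in the graph of `S*`. The pair `(x, y)` collects the
coefficients `x` of `e₊₊, e₋₋`, where the form `jForm` is of one sign, and `y` of `e₊₋, e₋₊`,
where it is of the other. -/
def ofCoords : ((Fin 2 → ℂ) × (Fin 2 → ℂ)) →ₗ[ℂ] H × H :=
  LinearMap.coprod
    (Fintype.linearCombination ℂ ![(e.pp, I • e.pp), (e.mm, -I • e.mm)])
    (Fintype.linearCombination ℂ ![(e.pm, I • e.pm), (e.mp, -I • e.mp)])

theorem ofCoords_apply (p : (Fin 2 → ℂ) × (Fin 2 → ℂ)) :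
    e.ofCoords p = p.1 0 • (e.pp, I • e.pp) + p.1 1 • (e.mm, -I • e.mm) +
      (p.2 0 • (e.pm, I • e.pm) + p.2 1 • (e.mp, -I • e.mp)) := by
  simp [ofCoords, Fintype.linearCombination_apply]

theorem fst_ofCoords (p : (Fin 2 → ℂ) × (Fin 2 → ℂ)) :
    (e.ofCoords p).1 =
      p.1 0 • e.pp + p.1 1 • e.mm + (p.2 0 • e.pm + p.2 1 • e.mp) := by
  rw [ofCoords_apply]
  rfl

variable {e}

theorem range_ofCoords (h : IsJSymmetric J S) :
    e.ofCoords.range = defectGraph S I ⊔ defectGraph S (-I) := by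
  simp only [ofCoords, LinearMap.range_coprod, Fintype.range_linearCombination, defectGraph,
    e.defect_I h, e.defect_neg_I h, Submodule.map_sup, Submodule.map_span, Set.image_singleton,
    Matrix.range_cons, Matrix.range_empty, Set.union_empty, Submodule.span_union,
    LinearMap.prod_apply, Function.prod, LinearMap.smul_apply, LinearMap.id_apply]
  ac_rfl

theorem graph_adjoint_eq (h : IsJSymmetric J S) :
    S.adjoint.graph = S.graph ⊔ e.ofCoords.range := by
  rw [range_ofCoords h, graph_adjoint_eq_sup h.dense h.closed h.symm (z := I) (by simp), conj_I]

theorem ofCoords_mem_graph_adjoint (h : IsJSymmetric J S) (p : (Fin 2 → ℂ) × (Fin 2 → ℂ)) :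
    e.ofCoords p ∈ S.adjoint.graph :=
  graph_adjoint_eq (e := e) h ▸ Submodule.mem_sup_right ⟨p, rfl⟩

theorem jForm_ofCoords (h : IsJSymmetric J S) (p q : (Fin 2 → ℂ) × (Fin 2 → ℂ)) :
    jForm J (e.ofCoords p) (e.ofCoords q) =
      -2 * I * ‖e.pp‖ ^ 2 * (star p.1 ⬝ᵥ q.1 - star p.2 ⬝ᵥ q.2) := by
  have hpp := (e.pp_mem h).1
  have hpm := (e.pm_mem h).1
  have hmp := (e.mp_mem h).1
  have hmm := (e.mm_mem h).1
  have horth {x y : H} (hx : x ∈ posSubspace J) (hy : y ∈ negSubspace J) :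
      inner ℂ x y = 0 ∧ inner ℂ y x = 0 :=
    ⟨h.inner_pos_neg_eq_zero hx hy, inner_eq_zero_symm.1 (h.inner_pos_neg_eq_zero hx hy)⟩
  rw [jForm_apply, ofCoords_apply, ofCoords_apply]
  simp only [Prod.fst_add, Prod.snd_add, Prod.smul_fst, Prod.smul_snd,
    map_add, map_smul, mem_posSubspace.1 hpp, mem_posSubspace.1 hmp, mem_negSubspace.1 hpm,
    mem_negSubspace.1 hmm, inner_add_left, inner_add_right, inner_smul_left, inner_smul_right,
    inner_neg_left, horth hpp hpm, horth hpp hmm, horth hmp hpm, horth hmp hmm,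
    inner_self_eq_norm_sq_to_K, e.norm_pm, e.norm_mp, e.norm_mm, dotProduct, Fin.sum_univ_two,
    Pi.star_apply, RCLike.star_def, map_neg, conj_I, coe_algebraMap]
  ring

/-- The part in `N_i ∔ N_{-i}` of an operator between `S` and `S*`, in the coordinates
`ofCoords`. -/
def coords (e : DefectBasis J S) (A : H →ₗ.[ℂ] H) : Submodule ℂ ((Fin 2 → ℂ) × (Fin 2 → ℂ)) :=
  A.graph.comap e.ofCoords

theorem graph_eq_sup_map_coords (h : IsJSymmetric J S) (hSA : S ≤ A)
    (hAS : A.graph ≤ S.adjoint.graph) : A.graph = S.graph ⊔ (e.coords A).map e.ofCoords := by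
  rw [coords, Submodule.map_comap_eq, ← sup_inf_assoc_of_le _ (LinearPMap.le_graph_of_le hSA),
    ← graph_adjoint_eq h, inf_eq_right.2 hAS]

theorem jForm_eq_zero_iff (hpp : e.pp ≠ 0) (h : IsJSymmetric J S) {u v : H × H}
    (hu : u ∈ S.graph) (hv : v ∈ S.graph) {p q : (Fin 2 → ℂ) × (Fin 2 → ℂ)} :
    jForm J (u + e.ofCoords p) (v + e.ofCoords q) = 0 ↔
      star p.1 ⬝ᵥ q.1 = star p.2 ⬝ᵥ q.2 := by
  rw [h.jForm_add_add hu hv (ofCoords_mem_graph_adjoint h p) (ofCoords_mem_graph_adjoint h q),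
    jForm_ofCoords h, mul_eq_zero, sub_eq_zero, or_iff_right (by simpa using hpp)]

theorem isHypermaximalNeutral_coords_iff (hpp : e.pp ≠ 0) (h : IsJSymmetric J S) (hSA : S ≤ A)
    (hAS : A.graph ≤ S.adjoint.graph) :
    IsHypermaximalNeutral (e.coords A) ↔
      ∀ p, p ∈ A.graph ↔ ∀ q ∈ A.graph, jForm J q p = 0 := by
  have hS : S.graph ≤ A.graph := LinearPMap.le_graph_of_le hSA
  have horth {u : H × H} (hu : u ∈ S.graph) (p : (Fin 2 → ℂ) × (Fin 2 → ℂ)) :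
      (∀ q ∈ A.graph, jForm J q (u + e.ofCoords p) = 0) ↔
        ∀ q ∈ e.coords A, star q.1 ⬝ᵥ p.1 = star q.2 ⬝ᵥ p.2 := by
    constructor
    · exact fun hp q hq => (jForm_eq_zero_iff hpp h S.graph.zero_mem hu).1
        (hp _ (A.graph.add_mem A.graph.zero_mem hq))
    · intro hp q hq
      rw [graph_eq_sup_map_coords (e := e) h hSA hAS] at hq
      obtain ⟨v, hv, _, ⟨q, hqA, rfl⟩, rfl⟩ := Submodule.mem_sup.1 hq
      exact (jForm_eq_zero_iff hpp h hv hu).2 (hp q hqA)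
  constructor
  · intro hneutral p
    refine ⟨fun hp q hq => ?_, fun hp => ?_⟩
    · rw [graph_eq_sup_map_coords (e := e) h hSA hAS] at hp
      obtain ⟨u, hu, _, ⟨p, hpA, rfl⟩, rfl⟩ := Submodule.mem_sup.1 hp
      exact (horth hu p).2 ((hneutral p).1 hpA) q hq
    · have hadj := h.mem_graph_adjoint_iff.2 fun q hq => hp q (hS hq)
      rw [graph_adjoint_eq (e := e) h] at hadj
      obtain ⟨u, hu, _, ⟨p, rfl⟩, rfl⟩ := Submodule.mem_sup.1 hadj
      exact A.graph.add_mem (hS hu) ((hneutral p).2 ((horth hu p).1 hp))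
  · intro hJA p
    have := horth S.graph.zero_mem p
    rw [zero_add] at this
    exact (hJA _).trans this

theorem eq_zero_of_ofCoords_mem_graph (hpp : e.pp ≠ 0) (h : IsJSymmetric J S)
    {p : (Fin 2 → ℂ) × (Fin 2 → ℂ)} (hp : e.ofCoords p ∈ S.graph) : p = 0 := by
  have hform (q : (Fin 2 → ℂ) × (Fin 2 → ℂ)) : star q.1 ⬝ᵥ p.1 = star q.2 ⬝ᵥ p.2 := by
    have := h.mem_graph_adjoint_iff.1 (ofCoords_mem_graph_adjoint (e := e) h q) _ hp
    refine (jForm_eq_zero_iff hpp h S.graph.zero_mem S.graph.zero_mem).1 ?_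
    rw [zero_add, zero_add, h.jForm_swap, this, map_zero, neg_zero]
  refine Prod.ext (dotProduct_eq_zero _ fun w => ?_) (dotProduct_eq_zero _ fun w => ?_)
  · simpa [dotProduct_comm] using hform (star w, 0)
  · simpa [dotProduct_comm] using (hform (0, star w)).symm

section extension

variable (e)

theorem M_eq_map_fst (U : Matrix (Fin 2) (Fin 2) ℂ) :
    e.M U = (U.vecMulLinear.graph.map e.ofCoords).map (LinearMap.fst ℂ H H) := by
  ext x
  rw [M, Submodule.mem_span_pair]
  constructor
  · rintro ⟨a, b, rfl⟩
    refine ⟨_, ⟨(![a, b], ![a, b] ᵥ* U), mem_graph_vecMulLinear.2 rfl, rfl⟩, ?_⟩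
    simp only [LinearMap.fst_apply, fst_ofCoords, Matrix.vecMul_eq_sum, Fin.sum_univ_two,
      Matrix.cons_val_zero, Matrix.cons_val_one, Pi.add_apply, Pi.smul_apply, smul_eq_mul]
    module
  · rintro ⟨_, ⟨⟨x, y⟩, hxy, rfl⟩, rfl⟩
    obtain rfl : y = x ᵥ* U := mem_graph_vecMulLinear.1 hxy
    refine ⟨x 0, x 1, ?_⟩
    simp only [LinearMap.fst_apply, fst_ofCoords, Matrix.vecMul_eq_sum, Fin.sum_univ_two,
      Pi.add_apply, Pi.smul_apply, smul_eq_mul]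
    module

variable {e}

theorem graph_extension (h : IsJSymmetric J S) (U : Matrix (Fin 2) (Fin 2) ℂ) :
    (e.extension U).graph = S.graph ⊔ U.vecMulLinear.graph.map e.ofCoords := by
  rw [extension, M_eq_map_fst, graph_adjoint_domRestrict_sup h.dense h.symm]
  rintro _ ⟨p, -, rfl⟩
  exact ofCoords_mem_graph_adjoint h p

theorem le_extension (h : IsJSymmetric J S) (U : Matrix (Fin 2) (Fin 2) ℂ) : S ≤ e.extension U :=
  LinearPMap.le_of_le_graph (graph_extension (e := e) h U ▸ le_sup_left)

theorem graph_extension_le (e : DefectBasis J S) (U : Matrix (Fin 2) (Fin 2) ℂ) :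
    (e.extension U).graph ≤ S.adjoint.graph :=
  LinearPMap.le_graph_of_le LinearPMap.domRestrict_le

theorem coords_extension (hpp : e.pp ≠ 0) (h : IsJSymmetric J S) (U : Matrix (Fin 2) (Fin 2) ℂ) :
    e.coords (e.extension U) = U.vecMulLinear.graph := by
  rw [coords, graph_extension h]
  refine le_antisymm (fun p hp => ?_) (Submodule.map_le_iff_le_comap.1 le_sup_right)
  obtain ⟨u, hu, _, ⟨q, hq, rfl⟩, hsum⟩ := Submodule.mem_sup.1 hp
  have hpq : e.ofCoords (p - q) ∈ S.graph := by rwa [map_sub, ← hsum, add_sub_cancel_right]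
  rwa [sub_eq_zero.1 (eq_zero_of_ofCoords_mem_graph hpp h hpq)]

theorem isJSelfAdjoint_extension (hpp : e.pp ≠ 0) (h : IsJSymmetric J S)
    {U : Matrix (Fin 2) (Fin 2) ℂ} (hU : U ∈ Matrix.unitaryGroup (Fin 2) ℂ) :
    IsJSelfAdjoint J (e.extension U) := by
  refine isJSelfAdjoint_iff.2 ⟨h.dense.mono (le_extension h U).1,
    (isHypermaximalNeutral_coords_iff hpp h (le_extension h U) (graph_extension_le e U)).1 ?_⟩
  rw [coords_extension hpp h]
  exact isHypermaximalNeutral_graph hU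

theorem bijOn_extension (hpp : e.pp ≠ 0) (h : IsJSymmetric J S) :
    Set.BijOn e.extension (Matrix.unitaryGroup (Fin 2) ℂ : Set (Matrix (Fin 2) (Fin 2) ℂ))
      (jSelfAdjointExtensions J S) := by
  refine ⟨fun U hU => ⟨le_extension h U, isJSelfAdjoint_extension hpp h hU⟩, fun U _ V _ hUV => ?_,
    fun A hA => ?_⟩
  · apply graph_vecMulLinear_injective
    simpa only [coords_extension hpp h] using congrArg e.coords hUV
  · have hAS := h.graph_le_graph_adjoint_of_le hA.1 hA.2
    obtain ⟨U, hU, hcoords⟩ := ((isHypermaximalNeutral_coords_iff hpp h hA.1 hAS).2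
      (isJSelfAdjoint_iff.1 hA.2).2).exists_eq_graph
    refine ⟨U, hU, LinearPMap.eq_of_eq_graph ?_⟩
    rw [graph_extension h, ← hcoords, graph_eq_sup_map_coords h hA.1 hAS]

end extension

end DefectBasis

end extensionCoordinates

section resolvent

open Filter Topology

variable {H : Type*} [NormedAddCommGroup H] [InnerProductSpace ℂ H] {A : H →ₗ.[ℂ] H}
  {J : H →L[ℂ] H} {μ : ℂ}

theorem IsJSelfAdjoint.isClosed (hA : IsJSelfAdjoint J A) : A.IsClosed := by
  have : (A.graph : Set (H × H)) =
      ⋂ u : A.domain, {p | inner ℂ (J (A u)) p.1 = inner ℂ (J u) p.2} := by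
    ext ⟨x, y⟩
    simp only [SetLike.mem_coe, Set.mem_iInter, Set.mem_ofPred_eq]
    exact hA.2 x y
  rw [LinearPMap.IsClosed, this]
  exact isClosed_iInter fun u => isClosed_eq (by fun_prop) (by fun_prop)

theorem mem_resolventSet_of_bijective_shift [CompleteSpace H] (hA : A.IsClosed)
    (hbij : Function.Bijective (shift A μ)) : μ ∈ resolventSet A := by
  have : CompleteSpace A.graph := hA.completeSpace_coe
  let E := ContinuousLinearEquiv.ofBijective (shift A μ) (LinearMap.ker_eq_bot.2 hbij.1)
    (LinearMap.range_eq_top.2 hbij.2)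
  refine ⟨ContinuousLinearMap.fst ℂ H H ∘L A.graph.subtypeL ∘L E.symm, fun y => ?_, fun x => ?_⟩
  · obtain ⟨x, hx, hAx⟩ := (LinearPMap.mem_graph_iff _).1 (E.symm y).2
    have hy : (E.symm y).1.2 - μ • (E.symm y).1.1 = y := E.apply_symm_apply y
    exact ⟨LinearPMap.mem_domain_of_mem_graph (E.symm y).2,
      (congrArg (· - _) ((congrArg A (Subtype.ext hx.symm)).trans hAx)).trans hy⟩
  · exact congrArg (fun p : A.graph => p.1.1) (E.symm_apply_apply ⟨(x, A x), A.mem_graph x⟩)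

theorem surjective_shift_of_mem_resolventSet (hμ : μ ∈ resolventSet A) :
    Function.Surjective (shift A μ) := fun y =>
  let ⟨R, hR, _⟩ := hμ
  let ⟨hy, hRy⟩ := hR y
  ⟨⟨_, A.mem_graph ⟨R y, hy⟩⟩, hRy⟩

theorem eventually_injective_shift (hμ : μ ∈ resolventSet A) :
    ∀ᶠ z in 𝓝 μ, Function.Injective (shift A z) := by
  obtain ⟨R, -, hR⟩ := hμ
  have hlim : Tendsto (fun z => ‖(z - μ) • R‖) (𝓝 μ) (𝓝 0) := by
    have hcont : Continuous fun z : ℂ => ‖(z - μ) • R‖ := by fun_prop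
    simpa using hcont.tendsto μ
  filter_upwards [hlim.eventually_lt_const one_pos] with z hz
  refine injective_shift_iff.2 fun x hx => ?_
  obtain ⟨u, rfl, hAu⟩ := (LinearPMap.mem_graph_iff _).1 hx
  replace hAu : A u = z • (u : H) := hAu
  have hfix : ((z - μ) • R) u = u := by
    rw [_root_.smul_apply, ← map_smul, sub_smul, ← hAu, hR]
  by_contra hne
  have hpos : 0 < ‖(u : H)‖ := norm_pos_iff.2 hne
  have hle := ((z - μ) • R).le_opNorm u
  rw [hfix] at hle
  nlinarith

theorem IsJSelfAdjoint.injective_shift_conj (hA : IsJSelfAdjoint J A) (hJ : J * J = 1)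
    (hsurj : Function.Surjective (shift A μ)) : Function.Injective (shift A (conj μ)) := by
  refine injective_shift_iff.2 fun x hx => ?_
  obtain ⟨⟨⟨u, v⟩, huv⟩, hsum⟩ := hsurj (J x)
  have hadj := (isJSelfAdjoint_iff.1 hA).2 _ |>.1 hx _ huv
  have hJx : J (v - μ • u) = x := (congrArg J hsum).trans (congrArg (fun T : H →L[ℂ] H => T x) hJ)
  rw [← inner_self_eq_zero (𝕜 := ℂ), ← hadj]
  nth_rw 1 [← hJx]
  rw [jForm_apply, map_sub, map_smul, inner_sub_left, inner_smul_left, inner_smul_right]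

theorem resolventSet_eq_empty (hJ : J * J = 1) (hA : IsJSelfAdjoint J A)
    (heig : ∀ z : ℂ, 0 < z.im → ¬ Function.Injective (shift A z)) : resolventSet A = ∅ := by
  refine Set.eq_empty_of_forall_notMem fun μ hμ => ?_
  rcases lt_or_ge μ.im 0 with hneg | hnonneg
  · exact heig (conj μ) (by simpa using hneg)
      (hA.injective_shift_conj hJ (surjective_shift_of_mem_resolventSet hμ))
  · have hclosure : μ ∈ closure {z : ℂ | 0 < z.im} := by
      rwa [closure_setOfPred_lt_im]
    obtain ⟨z, hz, hinj⟩ := ((mem_closure_iff_frequently.1 hclosure).and_eventually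
      (eventually_injective_shift hμ)).exists
    exact heig z hz hinj

end resolvent

namespace DefectBasis

variable {H : Type*} [NormedAddCommGroup H] [InnerProductSpace ℂ H] [CompleteSpace H]
  {S A : H →ₗ.[ℂ] H} {J : H →L[ℂ] H} {e : DefectBasis J S} {U : Matrix (Fin 2) (Fin 2) ℂ} {μ : ℂ}

theorem ofCoords_mem_graph_extension (h : IsJSymmetric J S) (U : Matrix (Fin 2) (Fin 2) ℂ)
    (x : Fin 2 → ℂ) : e.ofCoords (x, x ᵥ* U) ∈ (e.extension U).graph := by
  rw [graph_extension h]
  exact Submodule.mem_sup_right ⟨_, mem_graph_vecMulLinear.2 rfl, rfl⟩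

theorem surjective_shift_extension (hpp : e.pp ≠ 0) (h : IsJSymmetric J S) (hμ : 0 < μ.im)
    (hinj : Function.Injective (shift (e.extension U) μ)) :
    Function.Surjective (shift (e.extension U) μ) := by
  have := e.finiteDimensional_defect_neg_I h
  have him : 0 < (-I).im * (conj μ).im := by simpa using hμ
  have := finiteDimensional_defect h.dense h.closed h.symm him
  have hdim := finrank_defect_eq h.dense h.closed h.symm him
  refine surjective_shift_of_injective h.dense h.closed h.symm (le_extension h U) hμ.ne'
    ((e.ofCoords ∘ₗ LinearMap.id.prod U.vecMulLinear).codRestrict _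
      (ofCoords_mem_graph_extension h U)) (fun x hx => ?_)
      (by simpa [hdim] using e.finrank_defect_neg_I_le h) hinj
  exact congrArg Prod.fst (eq_zero_of_ofCoords_mem_graph hpp h hx)

theorem resolventSet_extension_eq_empty_iff_not_injective (hpp : e.pp ≠ 0) (h : IsJSymmetric J S)
    (hU : U ∈ Matrix.unitaryGroup (Fin 2) ℂ) :
    resolventSet (e.extension U) = ∅ ↔
      ∀ μ : ℂ, 0 < μ.im → ¬ Function.Injective (shift (e.extension U) μ) := by
  have hA := isJSelfAdjoint_extension hpp h hU
  refine ⟨fun hempty μ hμ hinj => ?_, resolventSet_eq_empty h.sq hA⟩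
  have hmem := mem_resolventSet_of_bijective_shift hA.isClosed
    ⟨hinj, surjective_shift_extension hpp h hμ hinj⟩
  rwa [hempty] at hmem

theorem eq_zero_of_fst_ofCoords_mem_domain (hpp : e.pp ≠ 0) (h : IsJSymmetric J S)
    {p : (Fin 2 → ℂ) × (Fin 2 → ℂ)} (hp : (e.ofCoords p).1 ∈ S.domain) : p = 0 := by
  obtain ⟨v, huv⟩ := LinearPMap.mem_domain_iff.1 hp
  have hv : v = (e.ofCoords p).2 := LinearPMap.mem_graph_snd_inj _
    (graph_le_graph_adjoint h.dense h.symm huv) (ofCoords_mem_graph_adjoint h p) rfl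
  subst hv
  exact eq_zero_of_ofCoords_mem_graph hpp h huv

theorem not_injective_shift_iff (hpp : e.pp ≠ 0) (h : IsJSymmetric J S) (hμ : μ.im ≠ 0)
    (hSA : S ≤ A) (hAS : A.graph ≤ S.adjoint.graph) :
    ¬ Function.Injective (shift A μ) ↔
      ∃ p ∈ e.coords A, p ≠ 0 ∧ (e.ofCoords p).1 ∈ S.domain ⊔ defect S μ := by
  rw [injective_shift_iff]
  push Not
  constructor
  · rintro ⟨f, hf, hf0⟩
    have hfμ : f ∈ defect S μ := hAS hf
    rw [graph_eq_sup_map_coords (e := e) h hSA hAS] at hf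
    obtain ⟨u, hu, _, ⟨p, hp, rfl⟩, hsum⟩ := Submodule.mem_sup.1 hf
    have huS := LinearPMap.mem_domain_of_mem_graph hu
    have hfst : u.1 + (e.ofCoords p).1 = f := congrArg Prod.fst hsum
    refine ⟨p, hp, ?_, ?_⟩
    · rintro rfl
      rw [map_zero, Prod.fst_zero, add_zero] at hfst
      have hdisj := disjoint_domain_sup_defect h.dense h.symm (w := conj μ) (μ := μ)
        (by rw [conj_im]; nlinarith [sq_pos_of_ne_zero hμ])
      exact hf0 (Submodule.disjoint_def.1 hdisj f (Submodule.mem_sup_left (hfst ▸ huS)) hfμ)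
    · rw [eq_sub_of_add_eq' hfst, sub_eq_neg_add]
      exact Submodule.add_mem_sup (neg_mem huS) hfμ
  · rintro ⟨p, hp, hp0, hpμ⟩
    obtain ⟨u, hu, f, hf, hsum⟩ := Submodule.mem_sup.1 hpμ
    obtain ⟨v, huv⟩ := LinearPMap.mem_domain_iff.1 hu
    have hmem : e.ofCoords p - (u, v) ∈ A.graph :=
      sub_mem hp (LinearPMap.le_graph_of_le hSA huv)
    have hfst : (e.ofCoords p - (u, v)).1 = f := by rw [Prod.fst_sub, ← hsum, add_sub_cancel_left]
    have hsnd : (e.ofCoords p - (u, v)).2 = μ • f :=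
      LinearPMap.mem_graph_snd_inj _ (hAS hmem) (mem_defect.1 hf) hfst
    refine ⟨f, (Prod.ext hfst hsnd : _ = (f, μ • f)) ▸ hmem, ?_⟩
    rintro rfl
    rw [add_zero] at hsum
    exact hp0 (eq_zero_of_fst_ofCoords_mem_domain hpp h (hsum ▸ hu))

theorem fst_ofCoords_mem_sup_defect_iff (hpp : e.pp ≠ 0) (h : IsJSymmetric J S) (hμ : 0 < μ.im)
    {p : (Fin 2 → ℂ) × (Fin 2 → ℂ)} :
    (e.ofCoords p).1 ∈ S.domain ⊔ defect S μ ↔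
      p.1 1 = -(p.2 0 * e.sMinus μ) ∧ p.2 1 = -(p.1 0 * e.sPlus μ) := by
  have hplus := (mem_graph_Sh h.dense h.symm hμ (e.pp_mem h).2
    (Submodule.smul_mem _ _ (e.mp_mem h).2)).1 (e.mem_graph_Sh_pp h hμ)
  have hminus := (mem_graph_Sh h.dense h.symm hμ (e.pm_mem h).2
    (Submodule.smul_mem _ _ (e.mm_mem h).2)).1 (e.mem_graph_Sh_pm h hμ)
  have hcomb := add_mem (Submodule.smul_mem _ (p.1 0) hplus) (Submodule.smul_mem _ (p.2 0) hminus)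
  set r : (Fin 2 → ℂ) × (Fin 2 → ℂ) :=
    (![0, p.1 1 + p.2 0 * e.sMinus μ], ![0, p.2 1 + p.1 0 * e.sPlus μ]) with hr
  have hrNeg : (e.ofCoords r).1 ∈ defect S (-I) := by
    simpa [fst_ofCoords, hr] using add_mem (Submodule.smul_mem _ _ (e.mm_mem h).2)
      (Submodule.smul_mem _ _ (e.mp_mem h).2)
  have hsplit : (e.ofCoords p).1 = p.1 0 • (e.pp - e.sPlus μ • e.mp) +
      p.2 0 • (e.pm - e.sMinus μ • e.mm) + (e.ofCoords r).1 := by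
    simp only [fst_ofCoords, hr, Matrix.cons_val_zero, Matrix.cons_val_one]
    module
  have hdisj := disjoint_domain_sup_defect h.dense h.symm (w := μ) (μ := -I) (by simpa using hμ)
  rw [hsplit, Submodule.add_mem_iff_right _ hcomb, ← add_eq_zero_iff_eq_neg,
    ← add_eq_zero_iff_eq_neg]
  constructor
  · intro hmem
    have hr0 : r = 0 := eq_zero_of_fst_ofCoords_mem_domain hpp h <| by
      rw [Submodule.disjoint_def.1 hdisj _ hmem hrNeg]
      exact S.domain.zero_mem
    exact ⟨congrFun (congrArg Prod.fst hr0) 1, congrFun (congrArg Prod.snd hr0) 1⟩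
  · rintro ⟨h₁, h₂⟩
    simp [fst_ofCoords, hr, h₁, h₂]

theorem sPlus_I (hpp : e.pp ≠ 0) (h : IsJSymmetric J S) : e.sPlus I = 0 := by
  have hmem : (e.ofCoords (![1, 0], 0)).1 ∈ S.domain ⊔ defect S I := by
    simpa [fst_ofCoords] using Submodule.mem_sup_right (e.pp_mem h).2
  simpa using (fst_ofCoords_mem_sup_defect_iff hpp h (by simp)).1 hmem

theorem sMinus_I (hpp : e.pp ≠ 0) (h : IsJSymmetric J S) : e.sMinus I = 0 := by
  have hmem : (e.ofCoords (0, ![1, 0])).1 ∈ S.domain ⊔ defect S I := by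
    simpa [fst_ofCoords] using Submodule.mem_sup_right (e.pm_mem h).2
  simpa using (fst_ofCoords_mem_sup_defect_iff hpp h (by simp)).1 hmem

theorem not_injective_shift_extension_iff (hpp : e.pp ≠ 0) (h : IsJSymmetric J S) (hμ : 0 < μ.im)
    (U : Matrix (Fin 2) (Fin 2) ℂ) :
    ¬ Function.Injective (shift (e.extension U) μ) ↔
      U 0 0 * U 1 1 * e.sMinus μ = (1 + U 1 0 * e.sMinus μ) * (U 0 1 + e.sPlus μ) := by
  let N : Matrix (Fin 2) (Fin 2) ℂ :=
    !![U 0 0 * e.sMinus μ, U 0 1 + e.sPlus μ; 1 + U 1 0 * e.sMinus μ, U 1 1]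
  have hN (x : Fin 2 → ℂ) : x ᵥ* N = 0 ↔ (e.ofCoords (x, x ᵥ* U)).1 ∈ S.domain ⊔ defect S μ := by
    rw [fst_ofCoords_mem_sup_defect_iff hpp h hμ, ← add_eq_zero_iff_eq_neg,
      ← add_eq_zero_iff_eq_neg, funext_iff, Fin.forall_fin_two]
    simp only [N, Matrix.vecMul_eq_sum, Fin.sum_univ_two, Pi.add_apply, Pi.smul_apply, smul_eq_mul,
      Matrix.of_apply, Matrix.cons_val', Matrix.cons_val_zero, Matrix.cons_val_one,
      Matrix.cons_val_fin_one, Pi.zero_apply]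
    refine and_congr (Eq.congr_left ?_) (Eq.congr_left ?_) <;> ring
  calc ¬ Function.Injective (shift (e.extension U) μ)
      ↔ ∃ x ≠ 0, x ᵥ* N = 0 := by
        rw [not_injective_shift_iff hpp h hμ.ne' (le_extension h U) (graph_extension_le e U),
          coords_extension hpp h]
        constructor
        · rintro ⟨⟨x, y⟩, hx, hx0, hmem⟩
          obtain rfl : y = x ᵥ* U := mem_graph_vecMulLinear.1 hx
          exact ⟨x, by rintro rfl; simp at hx0, (hN x).2 hmem⟩
        · rintro ⟨x, hx0, hx⟩
          exact ⟨(x, x ᵥ* U), mem_graph_vecMulLinear.2 rfl,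
            fun h0 => hx0 (congrArg Prod.fst h0), (hN x).1 hx⟩
    _ ↔ N.det = 0 := Matrix.exists_vecMul_eq_zero_iff
    _ ↔ _ := by
        rw [Matrix.det_fin_two_of, sub_eq_zero, mul_right_comm, mul_comm (U 0 1 + _)]

end DefectBasis

section unitary

theorem sum_norm_sq_row_of_mem_unitaryGroup {n : Type*} [Fintype n] [DecidableEq n]
    {U : Matrix n n ℂ} (hU : U ∈ Matrix.unitaryGroup n ℂ) (i : n) : ∑ j, ‖U i j‖ ^ 2 = 1 := by
  have hdiag := congrFun (congrFun (Matrix.mem_unitaryGroup_iff.1 hU) i) i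
  simp only [Matrix.mul_apply, Matrix.star_apply, RCLike.star_def, mul_conj', Matrix.one_apply_eq]
    at hdiag
  exact_mod_cast hdiag

variable {U : Matrix (Fin 2) (Fin 2) ℂ}

theorem norm_apply_zero_one_eq_of_mem_unitaryGroup (hU : U ∈ Matrix.unitaryGroup (Fin 2) ℂ) :
    ‖U 0 1‖ = ‖U 1 0‖ := by
  have hrow := sum_norm_sq_row_of_mem_unitaryGroup hU 0
  have hcol := sum_norm_sq_row_of_mem_unitaryGroup (Unitary.star_mem hU) 0
  simp only [Fin.sum_univ_two, Matrix.star_apply, norm_star] at hrow hcol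
  rw [← sq_eq_sq₀ (norm_nonneg _) (norm_nonneg _)]
  linarith

theorem norm_diag_of_mem_unitaryGroup (hU : U ∈ Matrix.unitaryGroup (Fin 2) ℂ)
    (h01 : U 0 1 = 0) (h10 : U 1 0 = 0) : ‖U 0 0‖ = 1 ∧ ‖U 1 1‖ = 1 := by
  have h₀ := sum_norm_sq_row_of_mem_unitaryGroup hU 0
  have h₁ := sum_norm_sq_row_of_mem_unitaryGroup hU 1
  simpa [Fin.sum_univ_two, h01, h10, -sq_eq_one_iff, pow_eq_one_iff_of_nonneg] using
    And.intro h₀ h₁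

theorem existsUnique_exp_two_mul_I_eq {z : ℂ} (hz : ‖z‖ = 1) :
    ∃! φ : ℝ, φ ∈ Set.Ico 0 Real.pi ∧ exp (2 * φ * I) = z := by
  have hexp (φ : ℝ) : exp (2 * φ * I) = Circle.exp (2 * φ) := by simp
  have hdouble {φ : ℝ} (hφ : φ ∈ Set.Ico 0 Real.pi) : 2 * φ ∈ Set.Ico 0 (2 * Real.pi) :=
    ⟨by linarith [hφ.1], by linarith [hφ.2]⟩
  obtain ⟨θ, rfl⟩ := (norm_eq_one_iff z).1 hz
  obtain ⟨ψ, hψ, hθψ⟩ := Circle.periodic_exp.exists_mem_Ico₀ Real.two_pi_pos θ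
  have hψθ : exp (2 * (ψ / 2 : ℝ) * I) = exp (θ * I) := by
    rw [hexp, mul_div_cancel₀ _ two_ne_zero, ← hθψ, Circle.coe_exp]
  refine ⟨ψ / 2, ⟨⟨by linarith [hψ.1], by linarith [hψ.2]⟩, hψθ⟩, fun φ ⟨hφ, hφθ⟩ => ?_⟩
  have hinj := Circle.exp_injOn_Ico (a := 0) (b := 2 * Real.pi) (sub_zero _).le
  have := hinj (hdouble hφ) hψ (Circle.ext (by rw [← hexp, hφθ, ← hθψ, Circle.coe_exp]))
  linarith

theorem eq_diagU_iff {φ γ : ℝ} :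
    U = diagU φ γ ↔ U 0 1 = 0 ∧ U 1 0 = 0 ∧ U 0 0 = exp (φ * I) * exp (γ * I) ∧
      U 0 0 * U 1 1 = exp (2 * φ * I) := by
  have hprod : exp (φ * I) * exp (γ * I) * (exp (φ * I) * exp (-γ * I)) = exp (2 * φ * I) := by
    simp only [← exp_add]
    congr 1
    ring
  rw [← Matrix.ext_iff]
  simp only [diagU, Fin.forall_fin_two, Matrix.smul_apply, Matrix.of_apply, Matrix.cons_val',
    Matrix.cons_val_zero, Matrix.cons_val_one, Matrix.cons_val_fin_one, smul_eq_mul, mul_zero]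
  constructor
  · rintro ⟨⟨h00, h01⟩, h10, h11⟩
    exact ⟨h01, h10, h00, by rw [h00, h11, hprod]⟩
  · rintro ⟨h01, h10, h00, hdet⟩
    rw [h00, ← hprod] at hdet
    exact ⟨⟨h00, h01⟩, h10, mul_left_cancel₀ (by simp) hdet⟩

theorem exists_eq_diagU_iff (hU : U ∈ Matrix.unitaryGroup (Fin 2) ℂ) {φ : ℝ} :
    (∃ γ ∈ Set.Ico 0 (2 * Real.pi), U = diagU φ γ) ↔
      U 0 1 = 0 ∧ U 1 0 = 0 ∧ U 0 0 * U 1 1 = exp (2 * φ * I) := by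
  constructor
  · rintro ⟨γ, -, hγ⟩
    obtain ⟨h01, h10, -, hdet⟩ := eq_diagU_iff.1 hγ
    exact ⟨h01, h10, hdet⟩
  · rintro ⟨h01, h10, hdet⟩
    have hnorm : ‖exp (-φ * I) * U 0 0‖ = 1 := by
      rw [norm_mul, (norm_diag_of_mem_unitaryGroup hU h01 h10).1, mul_one, ← ofReal_neg,
        norm_exp_ofReal_mul_I]
    obtain ⟨γ, ⟨hγ, hexp⟩, -⟩ := existsUnique_exp_two_mul_I_eq hnorm
    refine ⟨2 * γ, ⟨by linarith [hγ.1], by linarith [hγ.2]⟩, eq_diagU_iff.2 ⟨h01, h10, ?_, hdet⟩⟩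
    rw [ofReal_mul, ofReal_ofNat, hexp, ← mul_assoc, ← exp_add, ← add_mul, add_neg_cancel, zero_mul,
      exp_zero, one_mul]

theorem exists_exists_eq_diagU_iff (hU : U ∈ Matrix.unitaryGroup (Fin 2) ℂ) :
    (∃ φ ∈ Set.Ico 0 (2 * Real.pi), ∃ γ ∈ Set.Ico 0 (2 * Real.pi), U = diagU φ γ) ↔
      U 0 1 = 0 ∧ U 1 0 = 0 := by
  simp only [exists_eq_diagU_iff hU]
  refine ⟨fun ⟨_, _, h01, h10, _⟩ => ⟨h01, h10⟩, fun ⟨h01, h10⟩ => ?_⟩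
  obtain ⟨h00, h11⟩ := norm_diag_of_mem_unitaryGroup hU h01 h10
  obtain ⟨φ, ⟨hφ, hexp⟩, -⟩ := existsUnique_exp_two_mul_I_eq (z := U 0 0 * U 1 1)
    (by rw [norm_mul, h00, h11, one_mul])
  exact ⟨φ, ⟨hφ.1, by linarith [hφ.1, hφ.2]⟩, h01, h10, hexp.symm⟩

end unitary

namespace DefectBasis

variable {H : Type*} [NormedAddCommGroup H] [InnerProductSpace ℂ H] [CompleteSpace H]
  {S : H →ₗ.[ℂ] H} {J : H →L[ℂ] H} {e : DefectBasis J S} {U : Matrix (Fin 2) (Fin 2) ℂ}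

theorem shIsZero_iff (hpp : e.pp ≠ 0) (h : IsJSymmetric J S) :
    ShIsZero S ↔ ∀ μ : ℂ, 0 < μ.im → e.sPlus μ = 0 ∧ e.sMinus μ = 0 := by
  have hmp : e.mp ≠ 0 := norm_ne_zero_iff.1 (e.norm_mp ▸ norm_ne_zero_iff.2 hpp)
  have hmm : e.mm ≠ 0 := norm_ne_zero_iff.1 (e.norm_mm ▸ norm_ne_zero_iff.2 hpp)
  refine forall₂_congr fun μ hμ => ⟨fun hzero => ?_, fun ⟨hplus, hminus⟩ x => ?_⟩
  · have hsnd {x y : H} (hxy : (x, y) ∈ (Sh S μ).graph) : y = 0 := by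
      obtain ⟨a, -, hay⟩ := (LinearPMap.mem_graph_iff _).1 hxy
      exact hay.symm.trans (hzero a)
    exact ⟨(smul_eq_zero.1 (hsnd (e.mem_graph_Sh_pp h hμ))).resolve_right hmp,
      (smul_eq_zero.1 (hsnd (e.mem_graph_Sh_pm h hμ))).resolve_right hmm⟩
  · have hpp := e.mem_graph_Sh_pp h hμ
    have hpm := e.mem_graph_Sh_pm h hμ
    rw [hplus, zero_smul] at hpp
    rw [hminus, zero_smul] at hpm
    have hle : defect S I ≤ (Sh S μ).graph.comap (LinearMap.inl ℂ H H) := by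
      rw [e.defect_I h, sup_le_iff, Submodule.span_singleton_le_iff_mem,
        Submodule.span_singleton_le_iff_mem]
      exact ⟨hpp, hpm⟩
    exact LinearPMap.mem_graph_snd_inj _ ((Sh S μ).mem_graph x) (hle x.2.1) rfl

theorem resolventSet_extension_eq_empty_iff (hpp : e.pp ≠ 0) (h : IsJSymmetric J S)
    (hU : U ∈ Matrix.unitaryGroup (Fin 2) ℂ) :
    resolventSet (e.extension U) = ∅ ↔ U 0 1 = 0 ∧ U 1 0 = 0 ∧
      ∀ μ : ℂ, 0 < μ.im → U 0 0 * U 1 1 * e.sMinus μ = e.sPlus μ := by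
  rw [resolventSet_extension_eq_empty_iff_not_injective hpp h hU]
  constructor
  · intro heig
    have hdet (μ : ℂ) (hμ : 0 < μ.im) :=
      (not_injective_shift_extension_iff hpp h hμ U).1 (heig μ hμ)
    have h01 : U 0 1 = 0 := by
      simpa [sPlus_I hpp h, sMinus_I hpp h, eq_comm] using hdet I (by simp)
    have h10 : U 1 0 = 0 := by
      rw [← norm_eq_zero, ← norm_apply_zero_one_eq_of_mem_unitaryGroup hU, h01, norm_zero]
    exact ⟨h01, h10, fun μ hμ => by simpa [h01, h10] using hdet μ hμ⟩
  · rintro ⟨h01, h10, hs⟩ μ hμ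
    rw [not_injective_shift_extension_iff hpp h hμ, h01, h10, hs μ hμ]
    ring

theorem SApprox.exists_unimodular (hs : e.SApprox) :
    ∃ d : ℂ, ‖d‖ = 1 ∧ ∀ μ : ℂ, 0 < μ.im → d * e.sMinus μ = e.sPlus μ := by
  obtain ⟨α, hα⟩ := hs
  refine ⟨exp (-(α * I)), by rw [← neg_mul, ← ofReal_neg, norm_exp_ofReal_mul_I], fun μ hμ => ?_⟩
  rw [← hα μ hμ, ← mul_assoc, ← exp_add, neg_add_cancel, exp_zero, one_mul]

theorem forall_mul_sMinus_eq_iff (hpp : e.pp ≠ 0) (h : IsJSymmetric J S) (hSh : ¬ ShIsZero S)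
    {c d : ℂ} (hd : ∀ μ : ℂ, 0 < μ.im → d * e.sMinus μ = e.sPlus μ) :
    (∀ μ : ℂ, 0 < μ.im → c * e.sMinus μ = e.sPlus μ) ↔ c = d := by
  refine ⟨fun hc => ?_, fun hcd => hcd ▸ hd⟩
  by_contra hne
  refine hSh ((shIsZero_iff hpp h).2 fun μ hμ => ?_)
  have hminus : e.sMinus μ = 0 := by
    by_contra hs
    exact hne (mul_right_cancel₀ hs ((hc μ hμ).trans (hd μ hμ).symm))
  exact ⟨by rw [← hd μ hμ, hminus, mul_zero], hminus⟩

theorem existsUnique_phaseRelation (hpp : e.pp ≠ 0) (h : IsJSymmetric J S) (hSh : ¬ ShIsZero S)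
    (hs : e.SApprox) : ∃! φ : ℝ, φ ∈ Set.Ico 0 Real.pi ∧ e.PhaseRelation φ := by
  obtain ⟨d, hnorm, hd⟩ := hs.exists_unimodular
  simpa only [PhaseRelation, forall_mul_sMinus_eq_iff hpp h hSh hd] using
    existsUnique_exp_two_mul_I_eq hnorm

end DefectBasis

end JExt

end

theorem corollary3p2 {H : Type*} [NormedAddCommGroup H] [InnerProductSpace ℂ H] [CompleteSpace H]
    (J : H →L[ℂ] H) (hJ : JExt.IsFundamentalSymmetry J)
    (S : H →ₗ.[ℂ] H) (hdense : Dense (S.domain : Set H)) (hclosed : S.IsClosed)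
    (hsymm : S.IsFormalAdjoint S) (hcomm : JExt.CommutesWith S J)
    (hplus : JExt.HasDeficiencyIndices (JExt.part S (JExt.posSubspace J)) 1 1)
    (hminus : JExt.HasDeficiencyIndices (JExt.part S (JExt.negSubspace J)) 1 1)
    (e : JExt.DefectBasis J S) (hs : e.SApprox) :
    Set.BijOn e.extension (Matrix.unitaryGroup (Fin 2) ℂ : Set (Matrix (Fin 2) (Fin 2) ℂ))
        (JExt.jSelfAdjointExtensions J S) ∧
    (¬ JExt.ShIsZero S →
      (∃! φ : ℝ, φ ∈ Set.Ico 0 Real.pi ∧ e.PhaseRelation φ) ∧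
      ∀ φ : ℝ, e.PhaseRelation φ → ∀ U ∈ Matrix.unitaryGroup (Fin 2) ℂ,
        (JExt.resolventSet (e.extension U) = ∅ ↔
          ∃ γ ∈ Set.Ico 0 (2 * Real.pi), U = JExt.diagU φ γ)) ∧
    (JExt.ShIsZero S → ∀ U ∈ Matrix.unitaryGroup (Fin 2) ℂ,
      (JExt.resolventSet (e.extension U) = ∅ ↔
        ∃ φ ∈ Set.Ico 0 (2 * Real.pi), ∃ γ ∈ Set.Ico 0 (2 * Real.pi), U = JExt.diagU φ γ)) := by
  have h : JExt.IsJSymmetric J S := ⟨hJ.selfAdjoint, hJ.sq, hdense, hclosed, hsymm, hcomm⟩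
  have hpp : e.pp ≠ 0 := e.pp_ne_zero (by simpa using hplus.1)
  refine ⟨JExt.DefectBasis.bijOn_extension hpp h,
    fun hSh => ⟨JExt.DefectBasis.existsUnique_phaseRelation hpp h hSh hs, fun φ hφ U hU => ?_⟩,
    fun hSh U hU => ?_⟩
  · rw [JExt.DefectBasis.resolventSet_extension_eq_empty_iff hpp h hU,
      JExt.exists_eq_diagU_iff hU, JExt.DefectBasis.forall_mul_sMinus_eq_iff hpp h hSh hφ]
  · rw [JExt.DefectBasis.resolventSet_extension_eq_empty_iff hpp h hU,
      JExt.exists_exists_eq_diagU_iff hU]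
    refine and_congr_right fun _ => and_iff_left fun μ hμ => ?_
    obtain ⟨hplus, hminus⟩ := (JExt.DefectBasis.shIsZero_iff hpp h).1 hSh μ hμ
    rw [hplus, hminus, mul_zero]
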